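/- Let $T>0$, $n$ a dimension, and let $D\subseteq\mathbb R^n$ be an open set such that either $D=\mathbb R^n$ or $D$ is bounded with $C^2$-smooth boundary; put $Q=D\times(0,T)$. Let $b$, $f$, $\lambda$ be measurable functions on $Q$ with values in the symmetric $n\times n$ matrices, in $\mathbb R^n$ and in $\mathbb R$, such that $\xi^\top b(x,t)\xi\ge\delta|\xi|^2$ for all $\xi\in\mathbb R^n$, $(x,t)\in Q$, with some constant $\delta>0$, and $\operatorname{ess\,sup}_Q\bigl(|b|+|b^{-1}|+|f|+|\lambda|\bigr)<\infty$. Set $$\mathcal A u=\sum_{i,j=1}^n\frac{\partial}{\partial x_i}\Bigl(b_{ij}\frac{\partial u}{\partial x_j}\Bigr)+\sum_{i=1}^n f_i\frac{\partial u}{\partial x_i}+\lambda u .$$ Let $H^0=L_2(D)$, let $H^1$ be the closure in $W^1_2(D)$ of the smooth functions in $W_2^1(D)$ that vanish on $\partial D$, and let $H^{-1}$ be the dual space of $H^1$ with the dual norm, where $H^0$ is embedded in $H^{-1}$ through the pairing $(\cdot,\cdot)_{H^0}$. Let $X^k=L^2([0,T];H^k)$ for $k=-1,0,1$, and $Y^1=X^1\cap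 C([0,T];H^0)$. Let $B:X^0\to X^{-1}$ be a map and, for $K>0$, let $B_K(u)=e^{-Kt}B(e^{Kt}u)$. Assume that there are constants $K_*>0$ and $C_*>0$ such that $$\|B_K(u_1)-B_K(u_2)\|_{X^{-1}}\le C_*\|u_1-u_2\|_{X^0}\qquad\text{for all }u_1,u_2\in X^0\text{ and all }K>K_* .$$ Then for every $\varphi\in X^{-1}$ the problem $$\frac{\partial u}{\partial t}=\mathcal A u+B(u)+\varphi\ \text{ in } Q,\qquad u(x,0)=0,\qquad u(x,t)|_{x\in\partial D}=0$$ has a unique solution $u\in Y^1$. Here $u\in Y^1$ is a solution if $u(\cdot,0)=0$ and $u(\cdot,t)=\int_0^t(\mathcal A u+B(u)+\varphi)(\cdot,s)\,ds$ in $H^{-1}$ for all $t\in[0,T]$, that is, tested against every $w\in H^1$; the boundary condition is contained in $u(\cdot,t)\in H^1$ for almost every $t$. -/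

import Mathlib

open MeasureTheory Set Filter Topology
open scoped ContDiff

noncomputable section

namespace Parabolic

attribute [local instance] Matrix.frobeniusNormedAddCommGroup

/-- The Euclidean space `ℝⁿ`. -/
abbrev E (n : ℕ) : Type := EuclideanSpace ℝ (Fin n)

variable {n : ℕ}

/-- The boundary of the open set `D` is `C²`-smooth: near each of its boundary points, `D` is the
negativity set of a `C²` function whose gradient does not vanish at the point. -/
def HasC2Boundary (D : Set (E n)) : Prop :=
  ∀ x₀ ∈ frontier D, ∃ (U : Set (E n)) (ρ : E n → ℝ), IsOpen U ∧ x₀ ∈ U ∧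
    ContDiffOn ℝ 2 ρ U ∧ fderiv ℝ ρ x₀ ≠ 0 ∧ D ∩ U = {x ∈ U | ρ x < 0}

/-- Admissible spatial domains: the whole space, or a bounded open set with `C²` boundary. -/
def IsAdmissibleDomain (D : Set (E n)) : Prop :=
  IsOpen D ∧ (D = univ ∨ (Bornology.IsBounded D ∧ HasC2Boundary D))

/-- `H⁰ = L₂(D)`. -/
abbrev H0 (D : Set (E n)) : Type := Lp ℝ 2 (volume.restrict D)

/-- Pairs (function, vector field) in `L₂(D) × L₂(D; ℝⁿ)`, with the Hilbert norm
`(‖u‖² + ‖g‖²)^{1/2}`. -/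
abbrev L2Pair (D : Set (E n)) : Type :=
  WithLp 2 (Lp ℝ 2 (volume.restrict D) × Lp (E n) 2 (volume.restrict D))

/-- `g` is the distributional gradient of `u` in `D`. -/
def IsWeakGradient (D : Set (E n)) (u : E n → ℝ) (g : E n → E n) : Prop :=
  ∀ ψ : E n → ℝ, ContDiff ℝ ∞ ψ → HasCompactSupport ψ → tsupport ψ ⊆ D → ∀ i : Fin n,
    ∫ x in D, u x * fderiv ℝ ψ x (EuclideanSpace.single i 1) = - ∫ x in D, g x i * ψ x

lemma integrable_mul_test {D : Set (E n)} {u χ : E n → ℝ} (hu : MemLp u 2 (volume.restrict D))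
    (hχ : Continuous χ) (hc : HasCompactSupport χ) :
    Integrable (fun x => u x * χ x) (volume.restrict D) :=
  MemLp.integrable_mul (p := 2) (q := 2) hu (hχ.memLp_of_hasCompactSupport hc)

lemma memLp_coord {D : Set (E n)} (g : Lp (E n) 2 (volume.restrict D)) (i : Fin n) :
    MemLp (fun x => g x i) 2 (volume.restrict D) :=
  (EuclideanSpace.proj (𝕜 := ℝ) i).comp_memLp' (Lp.memLp g)

lemma test_fderiv {ψ : E n → ℝ} (h : ContDiff ℝ ∞ ψ) (hc : HasCompactSupport ψ) (i : Fin n) :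
    Continuous (fun x => fderiv ℝ ψ x (EuclideanSpace.single i 1)) ∧
      HasCompactSupport (fun x => fderiv ℝ ψ x (EuclideanSpace.single i 1)) :=
  ⟨(h.continuous_fderiv (by simp)).clm_apply continuous_const,
    hc.fderiv_apply (𝕜 := ℝ) (EuclideanSpace.single i 1)⟩

/-- The Sobolev space `W¹₂(D)`: the elements are the pairs `(u, ∇u)` with `u ∈ L₂(D)` and
distributional gradient `∇u ∈ L₂(D; ℝⁿ)`. -/
def W12 (D : Set (E n)) : Submodule ℝ (L2Pair D) where
  carrier := {p | IsWeakGradient D p.fst p.snd}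
  zero_mem' := by
    intro ψ _ _ _ i
    have h1 := Lp.coeFn_zero ℝ 2 (volume.restrict D)
    have h2 := Lp.coeFn_zero (E n) 2 (volume.restrict D)
    have e1 : ∫ x in D, (0 : L2Pair D).fst x * fderiv ℝ ψ x (EuclideanSpace.single i 1) = 0 := by
      apply integral_eq_zero_of_ae
      filter_upwards [h1] with x hx
      change (0 : Lp ℝ 2 (volume.restrict D)) x * _ = 0
      rw [hx, Pi.zero_apply, zero_mul]
    have e2 : ∫ x in D, (0 : L2Pair D).snd x i * ψ x = 0 := by
      apply integral_eq_zero_of_ae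
      filter_upwards [h2] with x hx
      change (0 : Lp (E n) 2 (volume.restrict D)) x i * _ = 0
      rw [hx, Pi.zero_apply, PiLp.zero_apply, zero_mul]
    rw [e1, e2, neg_zero]
  add_mem' := by
    intro p q hp hq ψ h1 h2 h3 i
    obtain ⟨c1, c2⟩ := test_fderiv h1 h2 i
    have e1 : ∫ x in D, (p + q).fst x * fderiv ℝ ψ x (EuclideanSpace.single i 1) =
        ∫ x in D, (p.fst x * fderiv ℝ ψ x (EuclideanSpace.single i 1) +
          q.fst x * fderiv ℝ ψ x (EuclideanSpace.single i 1)) := by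
      apply integral_congr_ae
      filter_upwards [Lp.coeFn_add p.fst q.fst] with x hx
      change (p.fst + q.fst) x * _ = _
      rw [hx, Pi.add_apply, add_mul]
    have e2 : ∫ x in D, (p + q).snd x i * ψ x =
        ∫ x in D, (p.snd x i * ψ x + q.snd x i * ψ x) := by
      apply integral_congr_ae
      filter_upwards [Lp.coeFn_add p.snd q.snd] with x hx
      change (p.snd + q.snd) x i * _ = _
      rw [hx, Pi.add_apply, PiLp.add_apply, add_mul]
    rw [e1, e2, integral_add (integrable_mul_test (Lp.memLp _) c1 c2)
      (integrable_mul_test (Lp.memLp _) c1 c2),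
      integral_add (integrable_mul_test (memLp_coord _ i) h1.continuous h2)
      (integrable_mul_test (memLp_coord _ i) h1.continuous h2), hp ψ h1 h2 h3 i, hq ψ h1 h2 h3 i]
    ring
  smul_mem' := by
    intro c p hp ψ h1 h2 h3 i
    have e1 : ∫ x in D, (c • p).fst x * fderiv ℝ ψ x (EuclideanSpace.single i 1) =
        ∫ x in D, c * (p.fst x * fderiv ℝ ψ x (EuclideanSpace.single i 1)) := by
      apply integral_congr_ae
      filter_upwards [Lp.coeFn_smul c p.fst] with x hx
      simp [hx, mul_assoc]
    have e2 : ∫ x in D, (c • p).snd x i * ψ x = ∫ x in D, c * (p.snd x i * ψ x) := by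
      apply integral_congr_ae
      filter_upwards [Lp.coeFn_smul c p.snd] with x hx
      simp [hx, mul_assoc]
    rw [e1, e2, integral_const_mul, integral_const_mul, hp ψ h1 h2 h3 i]
    ring

/-- The elements of `W¹₂(D)` given by functions that are smooth in `D`, continuous on the closure
of `D`, and zero on the boundary of `D`. -/
def smoothVanishing (D : Set (E n)) : Submodule ℝ (L2Pair D) where
  carrier := {p | p ∈ W12 D ∧ ∃ φ : E n → ℝ, ContDiffOn ℝ ∞ φ D ∧ ContinuousOn φ (closure D) ∧
    (∀ x ∈ frontier D, φ x = 0) ∧ p.fst =ᵐ[volume.restrict D] φ}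
  zero_mem' := ⟨zero_mem _, 0, contDiffOn_const, continuousOn_const, fun _ _ => rfl,
    Lp.coeFn_zero ℝ 2 (volume.restrict D)⟩
  add_mem' := by
    rintro p q ⟨hp, φ, a1, a2, a3, a4⟩ ⟨hq, χ, b1, b2, b3, b4⟩
    refine ⟨add_mem hp hq, φ + χ, a1.add b1, a2.add b2, fun x hx => ?_, ?_⟩
    · simp [a3 x hx, b3 x hx]
    · exact (Lp.coeFn_add p.fst q.fst).trans (a4.add b4)
  smul_mem' := by
    rintro c p ⟨hp, φ, a1, a2, a3, a4⟩
    refine ⟨Submodule.smul_mem _ c hp, c • φ, contDiffOn_const.smul a1, a2.const_smul c,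
      fun x hx => ?_, ?_⟩
    · simp [a3 x hx]
    · exact (Lp.coeFn_smul c p.fst).trans (a4.const_smul c)

/-- `H¹`: the closure in `W¹₂(D)` of the smooth functions vanishing on the boundary. -/
def H1sub (D : Set (E n)) : Submodule ℝ (L2Pair D) := (smoothVanishing D).topologicalClosure

/-- `H¹` as a Hilbert space; its norm is `(‖u‖² + ‖∇u‖²)^{1/2}`. -/
abbrev H1 (D : Set (E n)) : Type := H1sub D

/-- The embedding of `H¹` into `H⁰`. -/
def H1.toH0 {D : Set (E n)} (v : H1 D) : H0 D := (v : L2Pair D).fst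

/-- The gradient of an element of `H¹`. -/
def H1.grad {D : Set (E n)} (v : H1 D) : Lp (E n) 2 (volume.restrict D) := (v : L2Pair D).snd

/-- `H⁻¹`, the dual space of `H¹` with the dual norm. -/
abbrev Hneg1 (D : Set (E n)) : Type := StrongDual ℝ (H1 D)

/-- Lebesgue measure on `[0, T]`. -/
abbrev timeMeasure (T : ℝ) : Measure ℝ := volume.restrict (Icc 0 T)

/-- `L²([0, T]; V)`. -/
abbrev L2Time (T : ℝ) (V : Type) [NormedAddCommGroup V] : Type := Lp V 2 (timeMeasure T)

/-- `X⁰ = L²([0, T]; H⁰)`. -/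
abbrev X0 (T : ℝ) (D : Set (E n)) : Type := L2Time T (H0 D)

/-- `X¹ = L²([0, T]; H¹)`. -/
abbrev X1 (T : ℝ) (D : Set (E n)) : Type := L2Time T (H1 D)

/-- `X⁻¹ = L²([0, T]; H⁻¹)`. -/
abbrev Xneg1 (T : ℝ) (D : Set (E n)) : Type := L2Time T (Hneg1 D)

/-- `Y¹ = X¹ ∩ C([0, T]; H⁰)` with the norm `‖u‖_{X¹} + ‖u‖_{C⁰}`: an element is an element of `X¹`
together with the element of `C([0, T]; H⁰)` with which it agrees for almost every time. -/
def Y1sub (T : ℝ) (D : Set (E n)) : Submodule ℝ (WithLp 1 (X1 T D × C(Icc (0 : ℝ) T, H0 D))) where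
  carrier := {p | ∀ᵐ t ∂(timeMeasure T), ∀ ht : t ∈ Icc 0 T, (p.fst t).toH0 = p.snd ⟨t, ht⟩}
  zero_mem' := by
    filter_upwards [Lp.coeFn_zero (H1 D) 2 (timeMeasure T)] with t h ht
    change H1.toH0 ((0 : X1 T D) t) = 0
    rw [h]
    rfl
  add_mem' := by
    intro p q hp hq
    change ∀ᵐ t ∂(timeMeasure T), _
    filter_upwards [Lp.coeFn_add p.fst q.fst, hp, hq] with t h h1 h2 ht
    change H1.toH0 ((p.fst + q.fst) t) = p.snd ⟨t, ht⟩ + q.snd ⟨t, ht⟩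
    rw [h, ← h1 ht, ← h2 ht]
    rfl
  smul_mem' := by
    intro c p hp
    change ∀ᵐ t ∂(timeMeasure T), _
    filter_upwards [Lp.coeFn_smul c p.fst, hp] with t h h1 ht
    change H1.toH0 ((c • p.fst) t) = c • p.snd ⟨t, ht⟩
    rw [h, ← h1 ht]
    rfl

/-- The space `Y¹`. -/
abbrev Y1 (T : ℝ) (D : Set (E n)) : Type := Y1sub T D

/-- An element of `Y¹` as an element of `X¹`. -/
def Y1.toX1 {T : ℝ} {D : Set (E n)} (u : Y1 T D) : X1 T D :=
  (u : WithLp 1 (X1 T D × C(Icc (0 : ℝ) T, H0 D))).fst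

/-- An element of `Y¹` as a continuous function with values in `H⁰`. -/
def Y1.toC0 {T : ℝ} {D : Set (E n)} (u : Y1 T D) : C(Icc (0 : ℝ) T, H0 D) :=
  (u : WithLp 1 (X1 T D × C(Icc (0 : ℝ) T, H0 D))).snd

lemma memLp_toH0 {T : ℝ} {D : Set (E n)} (v : X1 T D) :
    MemLp (fun t => (v t).toH0) 2 (timeMeasure T) :=
  ((WithLp.fstL 2 ℝ (Lp ℝ 2 (volume.restrict D)) (Lp (E n) 2 (volume.restrict D))).comp
    (H1sub D).subtypeL).comp_memLp' (Lp.memLp v)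

/-- An element of `Y¹` as an element of `X⁰`. -/
def Y1.toX0 {T : ℝ} {D : Set (E n)} (u : Y1 T D) : X0 T D :=
  (memLp_toH0 u.toX1).toLp (fun t => (u.toX1 t).toH0)

lemma memLp_expMul {T : ℝ} {V : Type} [NormedAddCommGroup V] [NormedSpace ℝ V] (K : ℝ)
    (u : L2Time T V) : MemLp (fun t => Real.exp (K * t) • u t) 2 (timeMeasure T) := by
  refine MemLp.of_le_mul (c := Real.exp (|K| * T)) (Lp.memLp u) ?_ ?_
  · exact (by fun_prop : Continuous fun t : ℝ => Real.exp (K * t)).aestronglyMeasurable.smul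
      (Lp.aestronglyMeasurable u)
  · filter_upwards [ae_restrict_mem measurableSet_Icc] with t ht
    rw [norm_smul, Real.norm_eq_abs, Real.abs_exp]
    refine mul_le_mul_of_nonneg_right (Real.exp_le_exp.2 ?_) (norm_nonneg _)
    exact (mul_le_mul_of_nonneg_right (le_abs_self K) ht.1).trans
      (mul_le_mul_of_nonneg_left ht.2 (abs_nonneg K))

/-- Multiplication by `e^{Kt}` in `L²([0, T]; V)`. -/
def expMul {T : ℝ} {V : Type} [NormedAddCommGroup V] [NormedSpace ℝ V] (K : ℝ)
    (u : L2Time T V) : L2Time T V :=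
  (memLp_expMul K u).toLp (fun t => Real.exp (K * t) • u t)

/-- The rescaled map `B_K(u) = e^{-Kt} B(e^{Kt} u)`. -/
def rescale {T : ℝ} {D : Set (E n)} (B : X0 T D → Xneg1 T D) (K : ℝ) (u : X0 T D) : Xneg1 T D :=
  expMul (-K) (B (expMul K u))

/-- Conditions on the coefficients `b`, `f`, `λ` in `Q = D × (0, T)`: measurability, symmetry and
uniform ellipticity of `b`, and boundedness (matrices carry the Frobenius norm). -/
structure IsAdmissibleCoeff (T : ℝ) (D : Set (E n)) (b : E n × ℝ → Matrix (Fin n) (Fin n) ℝ)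
    (f : E n × ℝ → E n) (lam : E n × ℝ → ℝ) : Prop where
  measurable_b : ∀ i j, AEMeasurable (fun p => b p i j) (volume.restrict (D ×ˢ Ioo 0 T))
  measurable_f : AEMeasurable f (volume.restrict (D ×ˢ Ioo 0 T))
  measurable_lam : AEMeasurable lam (volume.restrict (D ×ˢ Ioo 0 T))
  symm : ∀ p ∈ D ×ˢ Ioo 0 T, (b p).IsSymm
  elliptic : ∃ δ : ℝ, 0 < δ ∧ ∀ p ∈ D ×ˢ Ioo 0 T, ∀ ξ : E n,
    δ * ‖ξ‖ ^ 2 ≤ ∑ i, ∑ j, ξ i * b p i j * ξ j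
  bounded : ∃ C : ℝ, ∀ᵐ p ∂(volume.restrict (D ×ˢ Ioo 0 T)),
    ‖b p‖ + ‖(b p)⁻¹‖ + ‖f p‖ + |lam p| ≤ C

/-- The pairing `(𝒜(t) v, w)_{H⁰}` for `v, w ∈ H¹`, where
`𝒜 v = ∑ ∂ᵢ (bᵢⱼ ∂ⱼ v) + ∑ fᵢ ∂ᵢ v + λ v`; the second-order term is understood in `H⁻¹`. -/
def formA (D : Set (E n)) (b : E n × ℝ → Matrix (Fin n) (Fin n) ℝ) (f : E n × ℝ → E n)
    (lam : E n × ℝ → ℝ) (t : ℝ) (v w : H1 D) : ℝ :=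
  ∫ x in D, (-(∑ i, ∑ j, b (x, t) i j * v.grad x j * w.grad x i)
    + (∑ i, f (x, t) i * v.grad x i) * w.toH0 x + lam (x, t) * v.toH0 x * w.toH0 x)

/-- `u ∈ Y¹` is a solution of `u_t = 𝒜 u + B(u) + φ`, `u(·, 0) = 0`, `u = 0` on the boundary:
`u(·, t) = ∫₀ᵗ (𝒜 u + B(u) + φ)(·, s) ds` holds in `H⁻¹` for all `t ∈ [0, T]`. The boundary
condition is contained in `u(·, t) ∈ H¹`. -/
structure IsSolution {T : ℝ} {D : Set (E n)} (b : E n × ℝ → Matrix (Fin n) (Fin n) ℝ)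
    (f : E n × ℝ → E n) (lam : E n × ℝ → ℝ) (B : X0 T D → Xneg1 T D) (φ : Xneg1 T D)
    (u : Y1 T D) : Prop where
  initial : ∀ h : (0 : ℝ) ∈ Icc 0 T, u.toC0 ⟨0, h⟩ = 0
  integrable : ∀ w : H1 D, IntegrableOn (fun s => formA D b f lam s (u.toX1 s) w) (Icc 0 T)
  equation : ∀ (w : H1 D) (t : Icc (0 : ℝ) T), inner ℝ (u.toC0 t) w.toH0 =
    ∫ s in (0 : ℝ)..t, (formA D b f lam s (u.toX1 s) w + B u.toX0 s w + φ s w)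

end Parabolic

end

/-! Write V = H¹, H = H⁰, let ι : V → H be the embedding, and represent V-dual values by Riesz
vectors. Integrated in time, the problem is one equation in W = L²([0,T]; V): G u = J (A u + N(ι
u)). Here G is ι*ι taken pointwise in time, J is x ↦ ∫₀ᵗ x, A represents the form of 𝒜, and N
collects B and φ. What matters is that G is symmetric and commutes with J, and that ⟨G x, J x⟩ =
½‖∫₀ᵀ ι x‖² ≥ 0.

Linear problem, -A coercive (`exists_solution_of_coercive`). The pairs (u, g) with G u = J g satisfy
⟨g, u⟩ ≥ 0, an integrated energy inequality obtained by approximating with pairs (J x, G x)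
(`exists_seq_tendsto_of_eq`, `inner_nonneg_of_eq`). Hence (u, g) ↦ g - A u is bounded below on the
closed space of such pairs, and its range is closed. A vector v orthogonal to the range satisfies G
v = J* A* v; the same inequality for J* gives ⟨A* v, v⟩ ≥ 0, so v = 0 by coercivity.

Semilinear problem (`existsUnique_semilinear`). Substituting u = e^{Kt} v replaces A by A - K G and
B by B_K, whose Lipschitz constant C does not depend on K. Gårding's inequality
(`IsGoodSlice.coercive`) then bounds α‖v‖² + (K - β)‖ι v‖² for differences v of solutions by C r
‖v‖, with r the X⁰ distance of the arguments of B_K. For large K the solution map is a contraction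
of X⁰, and its fixed point gives the solution.

Continuity in H (`exists_continuous_of_eq`) comes from the same approximation: the energy identity
makes the approximants Cauchy in C([0,T]; H). -/

noncomputable section

namespace Parabolic

attribute [local instance] Matrix.frobeniusNormedAddCommGroup

/-! ### Abstract linear evolution equations in a Hilbert space -/

section AbstractEvolution

variable {W : Type*} [NormedAddCommGroup W] [InnerProductSpace ℝ W] [CompleteSpace W]

/-- Since J is monotone, ε + J is coercive and hence invertible. Testing (ε + J) R x = x against R x
gives the norm bound. -/
lemma exists_resolvent {J : W →L[ℝ] W} (hJ : ∀ x, 0 ≤ inner ℝ (J x) x) {ε : ℝ} (hε : 0 < ε) :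
    ∃ R : W →L[ℝ] W, (∀ x, ε • R x + J (R x) = x) ∧ (∀ x, R (ε • x + J x) = x) ∧
      ∀ x, ‖ε • R x‖ ≤ ‖x‖ := by
  have key : ∀ x, ‖x‖ ^ 2 * ε ≤ inner ℝ (ε • x + J x) x := by
    intro x
    rw [inner_add_left, real_inner_smul_left, real_inner_self_eq_norm_sq]
    nlinarith [hJ x]
  have hunit : IsUnit (ε • ContinuousLinearMap.id ℝ W + J) := by
    refine ContinuousLinearMap.isUnit_of_forall_le_norm_inner_map _ (c := ⟨ε, hε.le⟩) hε ?_
    intro x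
    exact (key x).trans (le_abs_self _)
  obtain ⟨⟨S, R, h1, h2⟩, hS⟩ := hunit
  have hS' : S = ε • ContinuousLinearMap.id ℝ W + J := hS
  have e1 : ∀ x, ε • R x + J (R x) = x := by
    intro x
    have := DFunLike.congr_fun h1 x
    rw [hS'] at this
    simpa using this
  refine ⟨R, e1, fun x => ?_, fun x => ?_⟩
  · have := DFunLike.congr_fun h2 x
    rw [hS'] at this
    simpa using this
  · have h3 := key (R x)
    rw [e1] at h3
    have h4 := real_inner_le_norm x (R x)
    rw [norm_smul, Real.norm_eq_abs, abs_of_pos hε]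
    rcases (norm_nonneg (R x)).eq_or_lt with h0 | h0
    · rw [← h0, mul_zero]; exact norm_nonneg _
    · nlinarith

/-- Regularisation by x = (ε + J)⁻¹ u with ε → 0. As G commutes with J, it commutes with the
resolvent R, so G x = R J g = g - ε R g, while J x = u - ε R u. -/
lemma exists_seq_tendsto_of_eq {G J : W →L[ℝ] W} (hJ : ∀ x, 0 ≤ inner ℝ (J x) x)
    (hGJ : ∀ x, G (J x) = J (G x)) (hd : DenseRange J) {u g : W} (h : G u = J g) :
    ∃ x : ℕ → W, Tendsto (fun k => J (x k)) atTop (𝓝 u) ∧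
      Tendsto (fun k => G (x k)) atTop (𝓝 g) := by
  have hpos : ∀ k : ℕ, (0 : ℝ) < 1 / ((k : ℝ) + 1) := fun k => by positivity
  choose R hR1 hR2 hR3 using fun k => exists_resolvent hJ (hpos k)
  -- On the range of J one has ε R (J y) = ε (y - ε R y), of norm at most 2ε‖y‖. Density of that
  -- range and the uniform bound on ε R extend the limit to every x.
  have hlim : ∀ x : W, Tendsto (fun k : ℕ => (1 / ((k : ℝ) + 1)) • R k x) atTop (𝓝 0) := by
    intro x
    rw [Metric.tendsto_atTop]
    intro δ hδ
    obtain ⟨y, hy⟩ := hd.exists_dist_lt x (half_pos hδ)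
    have h1 := tendsto_one_div_add_atTop_nhds_zero_nat (𝕜 := ℝ)
    obtain ⟨N, hN⟩ := (Metric.tendsto_atTop.1 (h1.mul_const (2 * ‖y‖))) (δ / 2) (half_pos hδ)
    refine ⟨N, fun k hk => ?_⟩
    have h2 := hN k hk
    set ε : ℝ := 1 / ((k : ℝ) + 1) with hε
    rw [zero_mul, dist_zero_right, Real.norm_eq_abs, abs_of_nonneg
      (mul_nonneg (hpos k).le (by positivity))] at h2
    rw [dist_zero_right]
    have h3 : ε • R k x = ε • R k (x - J y) + ε • (y - ε • R k y) := by
      have : R k (J y) = y - ε • R k y := by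
        rw [eq_sub_iff_add_eq, add_comm, ← map_smul, ← map_add, hR2 k y]
      rw [map_sub, this, ← smul_add]
      congr 1
      abel
    rw [h3]
    have h4 : ‖ε • R k (x - J y)‖ < δ / 2 := (hR3 k _).trans_lt (by rwa [← dist_eq_norm])
    have h5 : ‖ε • (y - ε • R k y)‖ ≤ ε * (2 * ‖y‖) := by
      rw [norm_smul, Real.norm_eq_abs, abs_of_pos (hpos k)]
      refine mul_le_mul_of_nonneg_left ?_ (hpos k).le
      linarith [norm_sub_le y (ε • R k y), hR3 k y]
    linarith [norm_add_le (ε • R k (x - J y)) (ε • (y - ε • R k y))]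
  refine ⟨fun k => R k u, ?_, ?_⟩
  · have : ∀ k, J (R k u) = u - (1 / ((k : ℝ) + 1)) • R k u := fun k => by
      rw [eq_sub_iff_add_eq, add_comm, hR1]
    simp_rw [this]
    simpa using tendsto_const_nhds.sub (hlim u)
  · have : ∀ k, G (R k u) = g - (1 / ((k : ℝ) + 1)) • R k g := fun k => by
      have e1 : G (R k u) = R k (G u) := by
        conv_rhs => rw [← hR1 k u, map_add, map_smul, hGJ, hR2]
      rw [e1, h, eq_sub_iff_add_eq, add_comm, ← map_smul, ← map_add, hR2]
    simp_rw [this]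
    simpa using tendsto_const_nhds.sub (hlim g)

/-- For u = J x and g = G x this is `hpos`; general pairs are limits of such. It plays the role of
∫⟨u_t, u⟩ ≥ 0 for zero initial value. -/
lemma inner_nonneg_of_eq {G J : W →L[ℝ] W} (hJ : ∀ x, 0 ≤ inner ℝ (J x) x)
    (hGJ : ∀ x, G (J x) = J (G x)) (hd : DenseRange J) (hpos : ∀ x, 0 ≤ inner ℝ (G x) (J x))
    {u g : W} (h : G u = J g) : 0 ≤ inner ℝ g u := by
  obtain ⟨x, h1, h2⟩ := exists_seq_tendsto_of_eq hJ hGJ hd h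
  exact ge_of_tendsto' (h2.inner h1) fun k => hpos _

lemma denseRange_of_adjoint_injective {J : W →L[ℝ] W}
    (h : ∀ y, J.adjoint y = 0 → y = 0) : DenseRange J := by
  have : (LinearMap.range J.toLinearMap).topologicalClosure = ⊤ := by
    rw [Submodule.topologicalClosure_eq_top_iff, Submodule.eq_bot_iff]
    intro y hy
    refine h y (ext_inner_left ℝ fun v => ?_)
    rw [ContinuousLinearMap.adjoint_inner_right, inner_zero_right]
    exact hy _ ⟨v, rfl⟩
  have h2 := Submodule.dense_iff_topologicalClosure_eq_top.2 this
  exact h2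

/-- Solvability of `G u = J (A u + φ)`, the time-integrated form of an abstract linear evolution
equation, for coercive `-A`. -/
theorem exists_solution_of_coercive {G J A : W →L[ℝ] W}
    (hG : ∀ x y, inner ℝ (G x) y = inner ℝ x (G y))
    (hJ : ∀ x, 0 ≤ inner ℝ (J x) x) (hGJ : ∀ x, G (J x) = J (G x))
    (hJinj : ∀ y, J y = 0 → y = 0) (hJinj' : ∀ y, J.adjoint y = 0 → y = 0)
    (hpos : ∀ x, 0 ≤ inner ℝ (G x) (J x)) {α : ℝ} (hα : 0 < α)
    (hA : ∀ x, α * ‖x‖ ^ 2 ≤ -inner ℝ (A x) x) (φ : W) : ∃ u, G u = J (A u + φ) := by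
  have hd := denseRange_of_adjoint_injective hJinj'
  let S : Submodule ℝ (W × W) := LinearMap.ker
    ((G.comp (ContinuousLinearMap.fst ℝ W W) - J.comp (ContinuousLinearMap.snd ℝ W W) :
      W × W →L[ℝ] W) : W × W →ₗ[ℝ] W)
  have hS : ∀ p : W × W, p ∈ S ↔ G p.1 = J p.2 := by
    intro p
    change G p.1 - J p.2 = 0 ↔ _
    rw [sub_eq_zero]
  have hSc : IsClosed (S : Set (W × W)) := by
    have : (S : Set (W × W)) = {p | G p.1 = J p.2} := by ext p; exact hS p
    rw [this]
    exact isClosed_eq (by fun_prop) (by fun_prop)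
  have : CompleteSpace S := hSc.completeSpace_coe
  let L : S →L[ℝ] W := (ContinuousLinearMap.snd ℝ W W - A.comp (ContinuousLinearMap.fst ℝ W W)).comp
    S.subtypeL
  have hL : ∀ p : S, L p = p.1.2 - A p.1.1 := fun p => rfl
  -- A priori estimate: ⟨g - A u, u⟩ ≥ α‖u‖², because ⟨g, u⟩ ≥ 0.
  have hb1 : ∀ p : S, α * ‖p.1.1‖ ≤ ‖L p‖ := by
    intro p
    have h1 := inner_nonneg_of_eq hJ hGJ hd hpos ((hS _).1 p.2)
    have h2 : α * ‖p.1.1‖ ^ 2 ≤ ‖L p‖ * ‖p.1.1‖ := by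
      refine le_trans ?_ (real_inner_le_norm (L p) p.1.1)
      rw [hL, inner_sub_left]
      linarith [hA p.1.1]
    rcases (norm_nonneg p.1.1).eq_or_lt with h0 | h0
    · rw [← h0, mul_zero]; exact norm_nonneg _
    · nlinarith
  -- The second component is recovered from g = L p + A u, so the bound on u controls the whole
  -- pair.
  have hanti : ∃ K, AntilipschitzWith K L := by
    refine ⟨Real.toNNReal (1 + (1 + ‖A‖) * α⁻¹), AddMonoidHomClass.antilipschitz_of_bound L ?_⟩
    intro p
    rw [Real.coe_toNNReal _ (by positivity)]
    have h1 : ‖p.1.1‖ ≤ α⁻¹ * ‖L p‖ := by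
      rw [← div_eq_inv_mul, le_div_iff₀ hα, mul_comm]; exact hb1 p
    have h2 : ‖p.1.2‖ ≤ ‖L p‖ + ‖A‖ * ‖p.1.1‖ := by
      have : p.1.2 = L p + A p.1.1 := by rw [hL]; abel
      rw [this]
      exact (norm_add_le _ _).trans (by gcongr; exact A.le_opNorm _)
    have h3 : ‖p‖ ≤ ‖p.1.1‖ + ‖p.1.2‖ := by
      change max ‖p.1.1‖ ‖p.1.2‖ ≤ _
      exact max_le (by linarith [norm_nonneg p.1.2]) (by linarith [norm_nonneg p.1.1])
    have h4 := mul_le_mul_of_nonneg_left h1 (norm_nonneg A)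
    nlinarith
  obtain ⟨K, hK⟩ := hanti
  have hcl : IsClosed (LinearMap.range L.toLinearMap : Set W) := by
    have := hK.isClosed_range L.uniformContinuous
    exact this
  have htop : LinearMap.range L.toLinearMap = ⊤ := by
    rw [← hcl.submodule_topologicalClosure_eq, Submodule.topologicalClosure_eq_top_iff,
      Submodule.eq_bot_iff]
    intro v hv
    -- Orthogonality is tested only on the pairs (J x, G x), which lie in S because G and J commute.
    have h1 : G v = J.adjoint (A.adjoint v) := by
      refine ext_inner_left ℝ fun x => ?_
      have hx : ((J x, G x) : W × W) ∈ S := (hS _).2 (hGJ x)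
      have h2 : inner ℝ (L ⟨_, hx⟩) v = 0 := hv _ ⟨⟨_, hx⟩, rfl⟩
      rw [hL] at h2
      rw [inner_sub_left, sub_eq_zero] at h2
      rw [ContinuousLinearMap.adjoint_inner_right, ContinuousLinearMap.adjoint_inner_right, ← h2, hG]
    -- The energy inequality with J* in place of J; the range of J* is dense because J is injective.
    have h2 : 0 ≤ inner ℝ (A.adjoint v) v := by
      refine inner_nonneg_of_eq (G := G) (J := J.adjoint) ?_ ?_ ?_ ?_ h1
      · intro x
        rw [ContinuousLinearMap.adjoint_inner_left, real_inner_comm]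
        exact hJ x
      · intro x
        refine ext_inner_left ℝ fun y => ?_
        rw [← hG, ContinuousLinearMap.adjoint_inner_right, ContinuousLinearMap.adjoint_inner_right,
          ← hG, hGJ]
      · exact denseRange_of_adjoint_injective (by simpa using hJinj)
      · intro x
        rw [ContinuousLinearMap.adjoint_inner_right, ← hGJ, hG, real_inner_comm]
        exact hpos x
    rw [ContinuousLinearMap.adjoint_inner_left, real_inner_comm] at h2
    have h3 := hA v
    have h4 : ‖v‖ ^ 2 ≤ 0 := by nlinarith
    simpa using h4
  obtain ⟨p, hp⟩ := htop.ge (Submodule.mem_top (x := φ))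
  refine ⟨p.1.1, ?_⟩
  have h1 : p.1.2 = A p.1.1 + φ := by
    have : L p = φ := hp
    rw [← this, hL]; abel
  rw [← h1]
  exact (hS _).1 p.2

end AbstractEvolution

/-! ### Integration and exponential weights in L²([0, T]; V) -/

section TimeIntegration

variable {T : ℝ} {V V' : Type} [NormedAddCommGroup V] [InnerProductSpace ℝ V]
  [NormedAddCommGroup V'] [InnerProductSpace ℝ V']

lemma timeMeasure_restrict {t : ℝ} (ht : t ∈ Icc 0 T) :
    (timeMeasure T).restrict (Icc 0 t) = volume.restrict (Icc 0 t) := by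
  rw [timeMeasure, Measure.restrict_restrict measurableSet_Icc,
    inter_eq_left.2 (Icc_subset_Icc_right ht.2)]

lemma intervalIntegral_eq_timeMeasure {F : Type*} [NormedAddCommGroup F] [NormedSpace ℝ F]
    {t : ℝ} (ht : t ∈ Icc 0 T) (h : ℝ → F) :
    ∫ s in (0 : ℝ)..t, h s = ∫ s in Icc 0 t, h s ∂(timeMeasure T) := by
  rw [timeMeasure_restrict ht, intervalIntegral.integral_of_le ht.1, integral_Icc_eq_integral_Ioc]

lemma intervalIntegral_congr_timeMeasure {F : Type*} [NormedAddCommGroup F] [NormedSpace ℝ F]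
    {t : ℝ} (ht : t ∈ Icc 0 T) {h k : ℝ → F} (hk : h =ᵐ[timeMeasure T] k) :
    ∫ s in (0 : ℝ)..t, h s = ∫ s in (0 : ℝ)..t, k s := by
  rw [intervalIntegral_eq_timeMeasure ht, intervalIntegral_eq_timeMeasure ht]
  exact integral_congr_ae (ae_restrict_of_ae hk)

lemma intervalIntegrable_of_timeMeasure {F : Type*} [NormedAddCommGroup F]
    {t : ℝ} (ht : t ∈ Icc 0 T) {h : ℝ → F} (hh : Integrable h (timeMeasure T)) :
    IntervalIntegrable h volume 0 t := by
  rw [intervalIntegrable_iff_integrableOn_Icc_of_le ht.1]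
  exact IntegrableOn.mono_set hh (Icc_subset_Icc_right ht.2)

lemma integrable_L2Time {F : Type} [NormedAddCommGroup F] (x : L2Time T F) :
    Integrable x (timeMeasure T) :=
  (Lp.memLp x).integrable (by norm_num)

/-- Testing against c on [0, t] and 0 afterwards passes from identities in L² to integrals up to a
fixed time t. -/
lemma inner_indicatorConst {t : ℝ} (ht : t ∈ Icc 0 T) (x : L2Time T V) (c : V) :
    inner ℝ x (indicatorConstLp 2 (measurableSet_Icc : MeasurableSet (Icc 0 t))
      (measure_ne_top (timeMeasure T) _) c) = ∫ s in (0 : ℝ)..t, inner ℝ (x s) c := by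
  rw [real_inner_comm, L2.inner_indicatorConstLp_eq_setIntegral_inner,
    intervalIntegral_eq_timeMeasure ht]
  simp_rw [real_inner_comm]

lemma memLp_extend {F : Type} [NormedAddCommGroup F] (f : C(Icc (0 : ℝ) T, F)) :
    MemLp (fun t => open Classical in if h : t ∈ Icc 0 T then f ⟨t, h⟩ else 0) 2
      (timeMeasure T) := by
  refine MemLp.of_bound (C := ‖f‖) ?_ ?_
  · refine ContinuousOn.aestronglyMeasurable_of_isCompact ?_ isCompact_Icc measurableSet_Icc
    rw [continuousOn_iff_continuous_domRestrict]
    refine f.continuous.congr fun t => ?_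
    simp only [domRestrict_apply, dif_pos t.2, Subtype.coe_eta]
  · filter_upwards [ae_restrict_mem measurableSet_Icc] with t ht
    rw [dif_pos ht]
    exact f.norm_coe_le_norm _

/-- The embedding of `C([0, T]; V)` into `L²([0, T]; V)`. -/
def ofC (T : ℝ) (V : Type) [NormedAddCommGroup V] [NormedSpace ℝ V] :
    C(Icc (0 : ℝ) T, V) →L[ℝ] L2Time T V :=
  LinearMap.mkContinuous
    { toFun := fun f => (memLp_extend f).toLp _
      map_add' := fun f g => by
        rw [← MemLp.toLp_add, MemLp.toLp_eq_toLp_iff]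
        filter_upwards [ae_restrict_mem measurableSet_Icc] with t ht
        simp only [Pi.add_apply, dif_pos ht, ContinuousMap.add_apply]
      map_smul' := fun c f => by
        rw [RingHom.id_apply, ← MemLp.toLp_const_smul, MemLp.toLp_eq_toLp_iff]
        filter_upwards [ae_restrict_mem measurableSet_Icc] with t ht
        simp only [Pi.smul_apply, dif_pos ht, ContinuousMap.smul_apply] }
    ((measureUnivNNReal (timeMeasure T) : ℝ) ^ ((2 : ENNReal).toReal)⁻¹) (fun f => by
      refine Lp.norm_le_of_ae_bound (norm_nonneg _) ?_
      filter_upwards [ae_restrict_mem measurableSet_Icc, (memLp_extend f).coeFn_toLp] with t ht h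
      change ‖(memLp_extend f).toLp _ t‖ ≤ _
      rw [h, dif_pos ht]
      exact f.norm_coe_le_norm _)

lemma ofC_ae {F : Type} [NormedAddCommGroup F] [NormedSpace ℝ F] (f : C(Icc (0 : ℝ) T, F)) :
    ∀ᵐ t ∂(timeMeasure T), ∀ ht : t ∈ Icc 0 T, ofC T F f t = f ⟨t, ht⟩ := by
  filter_upwards [(memLp_extend f).coeFn_toLp] with t h ht
  change (memLp_extend f).toLp _ t = _
  rw [h, dif_pos ht]

lemma eq_of_ae_eq {F : Type*} [TopologicalSpace F] [T2Space F] (hT : 0 < T)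
    {f g : C(Icc (0 : ℝ) T, F)}
    (h : ∀ᵐ t ∂(timeMeasure T), ∀ ht : t ∈ Icc 0 T, f ⟨t, ht⟩ = g ⟨t, ht⟩) : f = g := by
  have h1 : EqOn (IccExtend hT.le f) (IccExtend hT.le g) (Icc 0 T) := by
    refine Measure.eqOn_Icc_of_ae_eq volume hT.ne ?_ f.continuous.Icc_extend'.continuousOn
      g.continuous.Icc_extend'.continuousOn
    filter_upwards [h, ae_restrict_mem measurableSet_Icc] with t h2 ht
    rw [IccExtend_of_mem _ _ ht, IccExtend_of_mem _ _ ht, h2 ht]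
  ext ⟨t, ht⟩
  have := h1 ht
  rwa [IccExtend_of_mem _ _ ht, IccExtend_of_mem _ _ ht] at this

/-- Density of bounded continuous functions, used to reduce identities about primitives to the
fundamental theorem of calculus. -/
lemma L2Time_induction {p : L2Time T V → Prop} (hp : IsClosed {x | p x})
    (h : ∀ (f : ℝ → V) (x : L2Time T V), Continuous f → x =ᵐ[timeMeasure T] f → p x)
    (x : L2Time T V) : p x := by
  refine (BoundedContinuousFunction.toLp_denseRange (p := 2) V (timeMeasure T) ℝ
    (by norm_num)).induction_on x hp fun f => ?_
  exact h f _ f.continuous (BoundedContinuousFunction.coeFn_toLp 2 (timeMeasure T) ℝ f)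

lemma ofC_injective (hT : 0 < T) {f g : C(Icc (0 : ℝ) T, V)} (h : ofC T V f = ofC T V g) :
    f = g := by
  refine eq_of_ae_eq hT ?_
  filter_upwards [ofC_ae f, ofC_ae g] with t h1 h2 ht
  rw [← h1 ht, ← h2 ht, h]

lemma expMul_ae {F : Type} [NormedAddCommGroup F] [NormedSpace ℝ F] (K : ℝ) (x : L2Time T F) :
    expMul K x =ᵐ[timeMeasure T] fun t => Real.exp (K * t) • x t :=
  (memLp_expMul K x).coeFn_toLp

lemma expMul_expMul_neg {F : Type} [NormedAddCommGroup F] [NormedSpace ℝ F] (K : ℝ)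
    (x : L2Time T F) : expMul K (expMul (-K) x) = x := by
  refine Lp.ext ?_
  filter_upwards [expMul_ae K (expMul (-K) x), expMul_ae (-K) x] with t h1 h2
  rw [h1, h2, smul_smul, ← Real.exp_add, neg_mul, add_neg_cancel, Real.exp_zero, one_smul]

/-- Multiplication by `e^{Kt}` as a bounded operator. -/
def expMulL (T : ℝ) (F : Type) [NormedAddCommGroup F] [NormedSpace ℝ F] (K : ℝ) :
    L2Time T F →L[ℝ] L2Time T F :=
  LinearMap.mkContinuous
    { toFun := expMul K
      map_add' := fun x y => by
        refine Lp.ext ?_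
        filter_upwards [expMul_ae K (x + y), expMul_ae K x, expMul_ae K y, Lp.coeFn_add x y,
          Lp.coeFn_add (expMul K x) (expMul K y)] with t h1 h2 h3 h4 h5
        rw [h1, h5, Pi.add_apply, h2, h3, h4, Pi.add_apply, smul_add]
      map_smul' := fun c x => by
        refine Lp.ext ?_
        filter_upwards [expMul_ae K (c • x), expMul_ae K x, Lp.coeFn_smul c x,
          Lp.coeFn_smul c (expMul K x)] with t h1 h2 h3 h4
        rw [h1, RingHom.id_apply, h4, Pi.smul_apply, h2, h3, Pi.smul_apply, smul_comm] }
    (Real.exp (|K| * T)) (fun x => by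
      refine Lp.norm_le_mul_norm_of_ae_le_mul ?_
      filter_upwards [expMul_ae K x, ae_restrict_mem measurableSet_Icc] with t h ht
      change ‖expMul K x t‖ ≤ _
      rw [h, norm_smul, Real.norm_eq_abs, Real.abs_exp]
      refine mul_le_mul_of_nonneg_right (Real.exp_le_exp.2 ?_) (norm_nonneg _)
      exact (mul_le_mul_of_nonneg_right (le_abs_self K) ht.1).trans
        (mul_le_mul_of_nonneg_left ht.2 (abs_nonneg K)))

lemma expMulL_apply {F : Type} [NormedAddCommGroup F] [NormedSpace ℝ F] (K : ℝ)
    (x : L2Time T F) : expMulL T F K x = expMul K x := rfl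

lemma expMul_compLpL (L : V →L[ℝ] V') (K : ℝ) (x : L2Time T V) :
    expMul K (L.compLpL 2 (timeMeasure T) x) = L.compLpL 2 (timeMeasure T) (expMul K x) := by
  refine Lp.ext ?_
  filter_upwards [expMul_ae K (L.compLpL 2 (timeMeasure T) x), expMul_ae K x, L.coeFn_compLpL x,
    L.coeFn_compLpL (expMul K x)] with t h1 h2 h3 h4
  rw [h1, h3, h4, h2, map_smul]

lemma continuous_primitive (x : L2Time T V) :
    Continuous fun t : Icc (0 : ℝ) T => ∫ s in (0 : ℝ)..t, x s := by
  rcases le_or_gt 0 T with hT | hT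
  · have h := intervalIntegral.continuousOn_primitive_interval' (a := 0)
      (intervalIntegrable_of_timeMeasure (right_mem_Icc.2 hT) (integrable_L2Time x)) left_mem_uIcc
    rw [uIcc_of_le hT] at h
    exact h.comp_continuous continuous_subtype_val fun t => t.2
  · have : IsEmpty (Icc (0 : ℝ) T) := isEmpty_coe_sort.2 (Icc_eq_empty hT.not_ge)
    exact continuous_of_const fun t => isEmptyElim t

variable [CompleteSpace V] [CompleteSpace V']

lemma intervalIntegral_inner_const {t : ℝ} (ht : t ∈ Icc 0 T) (x : L2Time T V) (c : V) :
    ∫ s in (0 : ℝ)..t, inner ℝ (x s) c = inner ℝ (∫ s in (0 : ℝ)..t, x s) c := by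
  simp_rw [real_inner_comm c]
  exact (innerSL ℝ c).intervalIntegral_comp_comm
    (intervalIntegrable_of_timeMeasure ht (integrable_L2Time x))

lemma norm_intervalIntegral_le {t : ℝ} (ht : t ∈ Icc 0 T) (x : L2Time T V) :
    ‖∫ s in (0 : ℝ)..t, x s‖ ≤ ‖x‖ * √T := by
  set c := ∫ s in (0 : ℝ)..t, x s with hc
  -- Cauchy–Schwarz against the function equal to the integral c itself on [0, t], whose norm is
  -- ‖c‖√t.
  have h1 : ‖c‖ ^ 2 ≤ ‖x‖ * (‖c‖ * √T) := by
    rw [← real_inner_self_eq_norm_sq]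
    nth_rw 1 [hc]
    rw [← intervalIntegral_inner_const ht, ← inner_indicatorConst ht]
    refine (real_inner_le_norm _ _).trans (mul_le_mul_of_nonneg_left ?_ (norm_nonneg _))
    rw [norm_indicatorConstLp (by norm_num) (by norm_num)]
    refine mul_le_mul_of_nonneg_left ?_ (norm_nonneg _)
    rw [measureReal_restrict_apply measurableSet_Icc, inter_eq_left.2 (Icc_subset_Icc_right ht.2),
      Real.volume_real_Icc_of_le ht.1, sub_zero, Real.sqrt_eq_rpow]
    norm_num
    exact Real.rpow_le_rpow ht.1 ht.2 (by norm_num)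
  rcases (norm_nonneg c).eq_or_lt with h0 | h0
  · rw [← h0]; positivity
  · nlinarith

/-- The primitive `t ↦ ∫₀ᵗ x`, as a map from `L²([0, T]; V)` to `C([0, T]; V)`. -/
def primC (T : ℝ) (V : Type) [NormedAddCommGroup V] [InnerProductSpace ℝ V] [CompleteSpace V] :
    L2Time T V →L[ℝ] C(Icc (0 : ℝ) T, V) :=
  LinearMap.mkContinuous
    { toFun := fun x => ⟨fun t => ∫ s in (0 : ℝ)..t, x s, continuous_primitive x⟩
      map_add' := fun x y => by
        ext t
        change ∫ s in (0 : ℝ)..t, (x + y) s =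
          (∫ s in (0 : ℝ)..t, x s) + ∫ s in (0 : ℝ)..t, y s
        rw [intervalIntegral_congr_timeMeasure t.2 (Lp.coeFn_add x y)]
        exact intervalIntegral.integral_add
          (intervalIntegrable_of_timeMeasure t.2 (integrable_L2Time x))
          (intervalIntegrable_of_timeMeasure t.2 (integrable_L2Time y))
      map_smul' := fun c x => by
        ext t
        change ∫ s in (0 : ℝ)..t, (c • x) s = c • ∫ s in (0 : ℝ)..t, x s
        rw [intervalIntegral_congr_timeMeasure t.2 (Lp.coeFn_smul c x)]
        exact intervalIntegral.integral_smul _ _ }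
    (√T) (fun x => by
      rw [ContinuousMap.norm_le _ (by positivity)]
      intro t
      rw [mul_comm]
      exact norm_intervalIntegral_le t.2 x)

lemma primC_apply (x : L2Time T V) (t : Icc (0 : ℝ) T) :
    primC T V x t = ∫ s in (0 : ℝ)..t, x s := rfl

lemma inner_primC (x : L2Time T V) (t : Icc (0 : ℝ) T) (c : V) :
    inner ℝ (primC T V x t) c = ∫ s in (0 : ℝ)..t, inner ℝ (x s) c := by
  rw [primC_apply, intervalIntegral_inner_const t.2]

/-- The integration operator `x ↦ ∫₀ᵗ x` in `L²([0, T]; V)`. -/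
def volterra (T : ℝ) (V : Type) [NormedAddCommGroup V] [InnerProductSpace ℝ V] [CompleteSpace V] :
    L2Time T V →L[ℝ] L2Time T V := (ofC T V).comp (primC T V)

lemma volterra_ae (x : L2Time T V) :
    ∀ᵐ t ∂(timeMeasure T), volterra T V x t = ∫ s in (0 : ℝ)..t, x s := by
  filter_upwards [ofC_ae (primC T V x), ae_restrict_mem measurableSet_Icc] with t h ht
  exact h ht

lemma primC_compLpL (L : V →L[ℝ] V') (x : L2Time T V) (t : Icc (0 : ℝ) T) :
    primC T V' (L.compLpL 2 (timeMeasure T) x) t = L (primC T V x t) := by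
  rw [primC_apply, primC_apply, intervalIntegral_congr_timeMeasure t.2 (L.coeFn_compLpL x)]
  exact L.intervalIntegral_comp_comm (intervalIntegrable_of_timeMeasure t.2 (integrable_L2Time x))

lemma volterra_compLpL (L : V →L[ℝ] V') (x : L2Time T V) :
    volterra T V' (L.compLpL 2 (timeMeasure T) x) =
      L.compLpL 2 (timeMeasure T) (volterra T V x) := by
  refine Lp.ext ?_
  filter_upwards [ofC_ae (primC T V' (L.compLpL 2 (timeMeasure T) x)), ofC_ae (primC T V x),
    L.coeFn_compLpL (volterra T V x), ae_restrict_mem measurableSet_Icc] with t h1 h2 h3 ht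
  rw [h3]
  exact (h1 ht).trans ((primC_compLpL L x ⟨t, ht⟩).trans (congrArg L (h2 ht)).symm)

/-- Integrates d/dt ‖F‖² = 2⟨F', F⟩ for F = ∫₀ᵗ x, first for continuous x. Both sides are continuous
in x for the L² norm, so the identity extends. -/
lemma energy_primC (x : L2Time T V) (t : Icc (0 : ℝ) T) :
    ‖primC T V x t‖ ^ 2 = 2 * ∫ s in (0 : ℝ)..t, inner ℝ (x s) (volterra T V x s) := by
  have hr : ∀ x : L2Time T V, ∫ s in (0 : ℝ)..t, inner ℝ (x s) (volterra T V x s) =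
      inner ℝ (LpToLpRestrictCLM ℝ V ℝ (timeMeasure T) 2 (Icc 0 t.1) x)
        (LpToLpRestrictCLM ℝ V ℝ (timeMeasure T) 2 (Icc 0 t.1) (volterra T V x)) := by
    intro x
    rw [L2.inner_def, intervalIntegral_eq_timeMeasure t.2]
    refine integral_congr_ae ?_
    filter_upwards [LpToLpRestrictCLM_coeFn ℝ (Icc 0 t.1) x,
      LpToLpRestrictCLM_coeFn ℝ (Icc 0 t.1) (volterra T V x)] with s h1 h2
    rw [h1, h2]
  rw [hr]
  refine L2Time_induction (p := fun x => ‖primC T V x t‖ ^ 2 = 2 *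
    inner ℝ (LpToLpRestrictCLM ℝ V ℝ (timeMeasure T) 2 (Icc 0 t.1) x)
        (LpToLpRestrictCLM ℝ V ℝ (timeMeasure T) 2 (Icc 0 t.1) (volterra T V x))) ?_ ?_ x
  · refine isClosed_eq ?_ (by fun_prop)
    exact (((continuous_eval_const t).comp (primC T V).continuous).norm.pow 2)
  · intro f x hf hx
    rw [← hr]
    have e1 : ∀ s ∈ Icc 0 T, ∫ r in (0 : ℝ)..s, x r = ∫ r in (0 : ℝ)..s, f r :=
      fun s hs => intervalIntegral_congr_timeMeasure hs hx
    have hd : ∀ s, HasDerivAt (fun s => ∫ r in (0 : ℝ)..s, f r) (f s) s := fun s =>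
      intervalIntegral.integral_hasDerivAt_right (hf.intervalIntegrable _ _)
        (hf.stronglyMeasurableAtFilter _ _) hf.continuousAt
    have hcF : Continuous fun s => ∫ r in (0 : ℝ)..s, f r :=
      continuous_iff_continuousAt.2 fun s => (hd s).continuousAt
    have e2 : ∫ s in (0 : ℝ)..t, inner ℝ (x s) (volterra T V x s) =
        ∫ s in (0 : ℝ)..t, inner ℝ (f s) (∫ r in (0 : ℝ)..s, f r) := by
      refine intervalIntegral_congr_timeMeasure t.2 ?_
      filter_upwards [hx, volterra_ae x, ae_restrict_mem measurableSet_Icc] with s h1 h2 hs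
      rw [h1, h2, e1 s hs]
    rw [e2, primC_apply, e1 t t.2]
    have h3 := intervalIntegral.integral_eq_sub_of_hasDerivAt (a := 0) (b := (t : ℝ))
      (fun s _ => (hd s).norm_sq) (Continuous.intervalIntegrable (by fun_prop) _ _)
    simp only [intervalIntegral.integral_same, norm_zero] at h3
    rw [intervalIntegral.integral_const_mul] at h3
    simp_rw [real_inner_comm] at h3 ⊢
    linarith

lemma inner_volterra_self (hT : 0 ≤ T) (x : L2Time T V) :
    inner ℝ (volterra T V x) x = ‖primC T V x ⟨T, hT, le_rfl⟩‖ ^ 2 / 2 := by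
  rw [energy_primC, intervalIntegral_eq_timeMeasure (T := T) ⟨hT, le_rfl⟩, L2.inner_def]
  simp only [timeMeasure, Measure.restrict_restrict measurableSet_Icc, inter_self]
  simp_rw [real_inner_comm]
  ring

lemma inner_volterra_self_nonneg (x : L2Time T V) : 0 ≤ inner ℝ (volterra T V x) x := by
  rcases le_or_gt 0 T with hT | hT
  · rw [inner_volterra_self hT]; positivity
  · have : inner ℝ (volterra T V x) x = 0 := by
      rw [L2.inner_def]
      simp [Icc_eq_empty hT.not_ge]
    rw [this]

lemma eq_zero_of_primC {x : L2Time T V} (h : primC T V x = 0) : x = 0 := by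
  have h0 : ∀ t ∈ Icc 0 T, ∫ s in (0 : ℝ)..t, x s = 0 := fun t ht => DFunLike.congr_fun h ⟨t, ht⟩
  have h2 : ∀ᵐ t ∂volume, t ∈ Icc 0 T → x t = 0 := by
    rcases le_or_gt 0 T with hT | hT
    -- Lebesgue differentiation of the vanishing primitive. The endpoints are discarded because the
    -- derivative is two-sided.
    · filter_upwards [(intervalIntegrable_of_timeMeasure (T := T) ⟨hT, le_rfl⟩
        (integrable_L2Time x)).ae_hasDerivAt_integral, compl_mem_ae_iff.2 (measure_singleton 0),
        compl_mem_ae_iff.2 (measure_singleton T)] with t h3 h4 h5 ht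
      rw [uIcc_of_le hT] at h3
      refine (h3 ht 0 ⟨le_rfl, hT⟩).unique ((hasDerivAt_const t (0 : V)).congr_of_eventuallyEq ?_)
      filter_upwards [Icc_mem_nhds (lt_of_le_of_ne ht.1 (Ne.symm h4)) (lt_of_le_of_ne ht.2 h5)]
        with s hs
      exact h0 s hs
    · simp [Icc_eq_empty hT.not_ge]
  refine (Lp.eq_zero_iff_ae_eq_zero).2 ?_
  exact (ae_restrict_iff' measurableSet_Icc).2 h2

lemma volterra_injective (hT : 0 < T) {x : L2Time T V} (h : volterra T V x = 0) : x = 0 := by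
  refine eq_zero_of_primC (ofC_injective hT ?_)
  rw [map_zero]
  exact h

/-- Polarisation of `inner_volterra_self`: the symmetric part of J sees only the integrals over [0,
T]. -/
lemma inner_volterra_add (hT : 0 ≤ T) (x y : L2Time T V) :
    inner ℝ (volterra T V x) y + inner ℝ (volterra T V y) x =
      inner ℝ (primC T V x ⟨T, hT, le_rfl⟩) (primC T V y ⟨T, hT, le_rfl⟩) := by
  have h1 := inner_volterra_self hT (x + y)
  have h2 := inner_volterra_self hT x
  have h3 := inner_volterra_self hT y
  rw [map_add, map_add, ContinuousMap.add_apply, inner_add_left, inner_add_right, inner_add_right,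
    norm_add_sq_real] at h1
  linarith

/-- If J* y = 0 then ⟨J y, y⟩ = 0, so ∫₀ᵀ y = 0 by the energy identity. The polarised identity then
gives J y = 0. -/
lemma volterra_adjoint_injective (hT : 0 < T) {y : L2Time T V}
    (h : (volterra T V).adjoint y = 0) : y = 0 := by
  have h1 : ∀ x, inner ℝ (volterra T V x) y = 0 := fun x => by
    rw [← ContinuousLinearMap.adjoint_inner_right, h, inner_zero_right]
  have h2 : primC T V y ⟨T, hT.le, le_rfl⟩ = 0 := by
    have := inner_volterra_self hT.le y
    rw [h1] at this
    have : ‖primC T V y ⟨T, hT.le, le_rfl⟩‖ ^ 2 = 0 := by linarith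
    simpa using this
  refine volterra_injective hT (ext_inner_right ℝ fun x => ?_)
  have := inner_volterra_add hT.le x y
  rw [h1, h2, inner_zero_right, zero_add] at this
  rw [this, inner_zero_left]

/-- The product rule for `e^{Kt} ∫₀ᵗ x`, in integrated form. -/
lemma expMul_volterra (K : ℝ) (x : L2Time T V) :
    expMul K (volterra T V x) =
      volterra T V (expMul K x + K • expMul K (volterra T V x)) := by
  simp only [← expMulL_apply]
  refine L2Time_induction (p := fun x => expMulL T V K (volterra T V x) =
      volterra T V (expMulL T V K x + K • expMulL T V K (volterra T V x))) ?_ ?_ x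
  · exact isClosed_eq (by fun_prop) (by fun_prop)
  · intro f x hf hx
    simp only [expMulL_apply]
    have e1 : ∀ s ∈ Icc 0 T, ∫ r in (0 : ℝ)..s, x r = ∫ r in (0 : ℝ)..s, f r :=
      fun s hs => intervalIntegral_congr_timeMeasure hs hx
    have hd : ∀ s, HasDerivAt (fun s => ∫ r in (0 : ℝ)..s, f r) (f s) s := fun s =>
      intervalIntegral.integral_hasDerivAt_right (hf.intervalIntegrable _ _)
        (hf.stronglyMeasurableAtFilter _ _) hf.continuousAt
    have hcF : Continuous fun s => ∫ r in (0 : ℝ)..s, f r :=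
      continuous_iff_continuousAt.2 fun s => (hd s).continuousAt
    have hde : ∀ s, HasDerivAt (fun s => Real.exp (K * s)) (Real.exp (K * s) * K) s := fun s => by
      simpa using ((hasDerivAt_id s).const_mul K).exp
    set y := expMul K x + K • expMul K (volterra T V x) with hy
    -- The right-hand side is the derivative of e^{Ks} ∫₀ˢ f, which vanishes at s = 0.
    have e2 : y =ᵐ[timeMeasure T] fun s => Real.exp (K * s) • f s +
        (Real.exp (K * s) * K) • ∫ r in (0 : ℝ)..s, f r := by
      filter_upwards [Lp.coeFn_add (expMul K x) (K • expMul K (volterra T V x)),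
        Lp.coeFn_smul K (expMul K (volterra T V x)), expMul_ae K x,
        expMul_ae K (volterra T V x), volterra_ae x, hx, ae_restrict_mem measurableSet_Icc]
        with s h1 h2 h3 h4 h5 h6 hs
      rw [h1, Pi.add_apply, h2, Pi.smul_apply, h3, h4, h5, h6, e1 s hs, smul_smul, mul_comm K (Real.exp _)]
    refine Lp.ext ?_
    filter_upwards [expMul_ae K (volterra T V x), volterra_ae x, volterra_ae y,
      ae_restrict_mem measurableSet_Icc] with t h1 h2 h3 ht
    rw [h1, h2, h3, e1 t ht, intervalIntegral_congr_timeMeasure ht e2,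
      intervalIntegral.integral_eq_sub_of_hasDerivAt (fun s _ => (hde s).smul (hd s))
        (Continuous.intervalIntegrable (by fun_prop) _ _)]
    simp

end TimeIntegration

/-! ### Measurable families of bilinear forms and Riesz representation -/

section TimeDependentForm

variable {T : ℝ} {V : Type} [NormedAddCommGroup V] [InnerProductSpace ℝ V]

/-- For simple u the composition is a finite sum of measurable pieces; continuity in the second
argument passes to the limit of simple approximants. -/
lemma aestronglyMeasurable_caratheodory {P : Type*} [TopologicalSpace P]
    {μ : Measure ℝ} {a : ℝ → P → ℝ} (hm : ∀ v, AEStronglyMeasurable (fun t => a t v) μ)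
    (hc : ∀ᵐ t ∂μ, Continuous (a t)) {u : ℝ → P} (hu : AEStronglyMeasurable u μ) :
    AEStronglyMeasurable (fun t => a t (u t)) μ := by
  have hs : ∀ s : SimpleFunc ℝ P, AEStronglyMeasurable (fun t => a t (s t)) μ := by
    intro s
    have : (fun t => a t (s t)) =
        fun t => ∑ v ∈ s.range, (s ⁻¹' {v}).indicator (fun t => a t v) t := by
      classical
      ext t
      rw [Finset.sum_eq_single (s t)]
      · rw [indicator_of_mem (by simp)]
      · intro v _ hv
        exact indicator_of_notMem (by simpa using hv.symm) _
      · intro h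
        exact absurd (s.mem_range_self t) h
    rw [this]
    exact Finset.aestronglyMeasurable_fun_sum _ fun v _ =>
      (hm v).indicator (s.measurableSet_preimage _)
  have h1 : AEStronglyMeasurable (fun t => a t (hu.mk u t)) μ := by
    refine aestronglyMeasurable_of_tendsto_ae atTop
      (fun k => hs (hu.stronglyMeasurable_mk.approx k)) ?_
    filter_upwards [hc] with t ht
    exact (ht.tendsto _).comp (hu.stronglyMeasurable_mk.tendsto_approx t)
  refine h1.congr ?_
  filter_upwards [hu.ae_eq_mk] with t ht
  rw [ht]

/-- A measurable family of bilinear forms, uniformly bounded for almost every time. -/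
structure IsBoundedFormFamily (T : ℝ) (M : ℝ) (a : ℝ → V → V → ℝ) : Prop where
  measurable : ∀ v w, AEStronglyMeasurable (fun t => a t v w) (timeMeasure T)
  bounded : ∀ᵐ t ∂(timeMeasure T), ∃ A : V →ₗ[ℝ] V →ₗ[ℝ] ℝ,
    (∀ v w, ‖A v w‖ ≤ M * ‖v‖ * ‖w‖) ∧ ∀ v w, A v w = a t v w

namespace IsBoundedFormFamily

variable {M : ℝ} {a : ℝ → V → V → ℝ}

lemma aestronglyMeasurable (h : IsBoundedFormFamily T M a) {u w : ℝ → V}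
    (hu : AEStronglyMeasurable u (timeMeasure T)) (hw : AEStronglyMeasurable w (timeMeasure T)) :
    AEStronglyMeasurable (fun t => a t (u t) (w t)) (timeMeasure T) := by
  refine aestronglyMeasurable_caratheodory (a := fun t (p : V × V) => a t p.1 p.2)
    (fun p => h.measurable p.1 p.2) ?_ (hu.prodMk hw)
  filter_upwards [h.bounded] with t ht
  obtain ⟨A, hM, hA⟩ := ht
  have h1 : ∀ v w, A.mkContinuous₂ M hM v w = a t v w := hA
  simp_rw [← h1]
  fun_prop

lemma ae_norm_le (h : IsBoundedFormFamily T M a) :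
    ∀ᵐ t ∂(timeMeasure T), ∀ v w, ‖a t v w‖ ≤ M * (‖v‖ * ‖w‖) := by
  filter_upwards [h.bounded] with t ht v w
  obtain ⟨A, hM, hA⟩ := ht
  rw [← hA, ← mul_assoc]
  exact hM v w

lemma integrable (h : IsBoundedFormFamily T M a) (u w : L2Time T V) :
    Integrable (fun t => a t (u t) (w t)) (timeMeasure T) := by
  have h1 : Integrable (fun t => ‖u t‖ * ‖w t‖) (timeMeasure T) :=
    MemLp.integrable_mul (p := 2) (q := 2) (Lp.memLp u).norm (Lp.memLp w).norm
  refine (h1.const_mul M).mono'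
    (h.aestronglyMeasurable (Lp.aestronglyMeasurable u) (Lp.aestronglyMeasurable w)) ?_
  filter_upwards [h.ae_norm_le] with t ht
  exact ht _ _

end IsBoundedFormFamily

lemma integral_norm_mul_norm_le {α : Type*} {m : MeasurableSpace α} {μ : Measure α}
    {F G : Type*} [NormedAddCommGroup F] [NormedAddCommGroup G] (u : Lp F 2 μ) (w : Lp G 2 μ) :
    ∫ t, ‖u t‖ * ‖w t‖ ∂μ ≤ ‖u‖ * ‖w‖ := by
  have h1 := (Lp.memLp u).norm
  have h2 := (Lp.memLp w).norm
  have h3 : ∫ t, ‖u t‖ * ‖w t‖ ∂μ = inner ℝ (h1.toLp _) (h2.toLp _) := by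
    rw [L2.inner_def]
    refine integral_congr_ae ?_
    filter_upwards [h1.coeFn_toLp, h2.coeFn_toLp] with t e1 e2
    rw [e1, e2, real_inner_eq_re_inner, RCLike.inner_apply]
    simp [mul_comm]
  rw [h3]
  refine (real_inner_le_norm _ _).trans_eq ?_
  rw [Lp.norm_toLp, Lp.norm_toLp, eLpNorm_norm, eLpNorm_norm, Lp.norm_def, Lp.norm_def]

/-- The operator in `L²([0, T]; V)` induced by a bounded family of bilinear forms. -/
lemma IsBoundedFormFamily.exists_operator [CompleteSpace V] {M : ℝ} {a : ℝ → V → V → ℝ}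
    (h : IsBoundedFormFamily T M a) (hM : 0 ≤ M) :
    ∃ A : L2Time T V →L[ℝ] L2Time T V,
      ∀ u w, inner ℝ (A u) w = ∫ t, a t (u t) (w t) ∂(timeMeasure T) := by
  let L : L2Time T V →ₗ[ℝ] L2Time T V →ₗ[ℝ] ℝ := LinearMap.mk₂ ℝ
    (fun (u w : L2Time T V) => ∫ t, a t (u t) (w t) ∂(timeMeasure T))
    (fun u₁ u₂ w => by
      rw [← integral_add (h.integrable _ _) (h.integrable _ _)]
      refine integral_congr_ae ?_
      filter_upwards [h.bounded, Lp.coeFn_add u₁ u₂] with t ht h1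
      obtain ⟨A, -, hA⟩ := ht
      rw [h1, Pi.add_apply]
      simp_rw [← hA]
      simp)
    (fun c u w => by
      rw [smul_eq_mul, ← integral_const_mul]
      refine integral_congr_ae ?_
      filter_upwards [h.bounded, Lp.coeFn_smul c u] with t ht h1
      obtain ⟨A, -, hA⟩ := ht
      rw [h1, Pi.smul_apply]
      simp_rw [← hA]
      simp)
    (fun u w₁ w₂ => by
      rw [← integral_add (h.integrable _ _) (h.integrable _ _)]
      refine integral_congr_ae ?_
      filter_upwards [h.bounded, Lp.coeFn_add w₁ w₂] with t ht h1
      obtain ⟨A, -, hA⟩ := ht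
      rw [h1, Pi.add_apply]
      simp_rw [← hA]
      simp)
    (fun c u w => by
      rw [smul_eq_mul, ← integral_const_mul]
      refine integral_congr_ae ?_
      filter_upwards [h.bounded, Lp.coeFn_smul c w] with t ht h1
      obtain ⟨A, -, hA⟩ := ht
      rw [h1, Pi.smul_apply]
      simp_rw [← hA]
      simp)
  have hL : ∀ u w, ‖L u w‖ ≤ M * ‖u‖ * ‖w‖ := by
    intro u w
    change ‖∫ t, a t (u t) (w t) ∂(timeMeasure T)‖ ≤ _
    have h1 : Integrable (fun t => ‖u t‖ * ‖w t‖) (timeMeasure T) :=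
      MemLp.integrable_mul (p := 2) (q := 2) (Lp.memLp u).norm (Lp.memLp w).norm
    refine (norm_integral_le_of_norm_le (h1.const_mul M) ?_).trans ?_
    · filter_upwards [h.ae_norm_le] with t ht
      exact ht _ _
    · rw [integral_const_mul, mul_assoc]
      exact mul_le_mul_of_nonneg_left (integral_norm_mul_norm_le u w) hM
  refine ⟨InnerProductSpace.continuousLinearMapOfBilin (𝕜 := ℝ) (L.mkContinuous₂ M hL), ?_⟩
  intro u w
  rw [InnerProductSpace.continuousLinearMapOfBilin_apply]
  rfl

/-- The Riesz representation of `L²([0, T]; V')` in `L²([0, T]; V)`. -/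
lemma exists_riesz (T : ℝ) (V : Type) [NormedAddCommGroup V] [InnerProductSpace ℝ V]
    [CompleteSpace V] :
    ∃ R : L2Time T (StrongDual ℝ V) →L[ℝ] L2Time T V, (∀ φ, ‖R φ‖ ≤ ‖φ‖) ∧
      ∀ φ w, inner ℝ (R φ) w = ∫ t, φ t (w t) ∂(timeMeasure T) := by
  have hint : ∀ (φ : L2Time T (StrongDual ℝ V)) (w : L2Time T V),
      (ContinuousLinearMap.id ℝ (StrongDual ℝ V)).lpPairing (timeMeasure T) 2 2 φ w =
        ∫ t, φ t (w t) ∂(timeMeasure T) := by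
    intro φ w
    rw [ContinuousLinearMap.lpPairing_eq_integral]
    rfl
  let R : L2Time T (StrongDual ℝ V) →ₗ[ℝ] L2Time T V :=
    { toFun := fun φ => (InnerProductSpace.toDual ℝ (L2Time T V)).symm
        ((ContinuousLinearMap.id ℝ (StrongDual ℝ V)).lpPairing (timeMeasure T) 2 2 φ)
      map_add' := fun φ χ => by rw [map_add, map_add]
      map_smul' := fun c φ => by rw [map_smul, map_smulₛₗ]; rfl }
  have hR : ∀ φ w, inner ℝ (R φ) w = ∫ t, φ t (w t) ∂(timeMeasure T) := by
    intro φ w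
    rw [← hint]
    exact InnerProductSpace.toDual_symm_apply
  have hb : ∀ φ, ‖R φ‖ ≤ 1 * ‖φ‖ := by
    intro φ
    rw [one_mul]
    have h1 : ‖R φ‖ * ‖R φ‖ ≤ ‖φ‖ * ‖R φ‖ := by
      rw [← real_inner_self_eq_norm_mul_norm, hR]
      have h1 : Integrable (fun t => ‖φ t‖ * ‖R φ t‖) (timeMeasure T) :=
        MemLp.integrable_mul (p := 2) (q := 2) (Lp.memLp φ).norm (Lp.memLp (R φ)).norm
      refine le_trans (le_trans (Real.le_norm_self _) (norm_integral_le_of_norm_le h1 ?_))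
        (integral_norm_mul_norm_le φ (R φ))
      filter_upwards with t
      exact (φ t).le_opNorm _
    rcases (norm_nonneg (R φ)).eq_or_lt with h0 | h0
    · rw [← h0]; exact norm_nonneg _
    · exact le_of_mul_le_mul_right h1 h0
  exact ⟨R.mkContinuous 1 hb, fun φ => (hb φ).trans_eq (one_mul _), hR⟩

end TimeDependentForm

/-! ### Bounds, Gårding's inequality and measurability for the form of 𝒜 -/

section SpatialForm

variable {n : ℕ} {D : Set (E n)} {b : E n × ℝ → Matrix (Fin n) (Fin n) ℝ} {f : E n × ℝ → E n}
  {lam : E n × ℝ → ℝ} {t C δ : ℝ}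

lemma H1.norm_sq (v : H1 D) : ‖v‖ ^ 2 = ‖v.toH0‖ ^ 2 + ‖v.grad‖ ^ 2 :=
  WithLp.prod_norm_sq_eq_of_L2 (v : L2Pair D)

lemma H1.norm_toH0_le (v : H1 D) : ‖v.toH0‖ ≤ ‖v‖ :=
  le_of_sq_le_sq (by rw [H1.norm_sq v]; linarith [sq_nonneg ‖v.grad‖]) (norm_nonneg _)

lemma H1.norm_grad_le (v : H1 D) : ‖v.grad‖ ≤ ‖v‖ :=
  le_of_sq_le_sq (by rw [H1.norm_sq v]; linarith [sq_nonneg ‖v.toH0‖]) (norm_nonneg _)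

lemma H1.toH0_add_ae (v w : H1 D) :
    (v + w).toH0 =ᵐ[volume.restrict D] fun x => v.toH0 x + w.toH0 x :=
  Lp.coeFn_add v.toH0 w.toH0

lemma H1.toH0_smul_ae (c : ℝ) (v : H1 D) :
    (c • v).toH0 =ᵐ[volume.restrict D] fun x => c * v.toH0 x :=
  Lp.coeFn_smul c v.toH0

lemma H1.grad_add_ae (v w : H1 D) :
    (v + w).grad =ᵐ[volume.restrict D] fun x => v.grad x + w.grad x :=
  Lp.coeFn_add v.grad w.grad

lemma H1.grad_smul_ae (c : ℝ) (v : H1 D) :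
    (c • v).grad =ᵐ[volume.restrict D] fun x => c • v.grad x :=
  Lp.coeFn_smul c v.grad

/-- The density of the form `formA`. -/
def formDensity (b : E n × ℝ → Matrix (Fin n) (Fin n) ℝ) (f : E n × ℝ → E n)
    (lam : E n × ℝ → ℝ) (t : ℝ) (v w : H1 D) (x : E n) : ℝ :=
  -(∑ i, ∑ j, b (x, t) i j * v.grad x j * w.grad x i)
    + (∑ i, f (x, t) i * v.grad x i) * w.toH0 x + lam (x, t) * v.toH0 x * w.toH0 x

lemma formA_eq (v w : H1 D) :
    formA D b f lam t v w = ∫ x in D, formDensity b f lam t v w x := rfl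

/-- The coefficients at time `t` are measurable, bounded by `C`, and elliptic with constant `δ`. -/
structure IsGoodSlice (D : Set (E n)) (b : E n × ℝ → Matrix (Fin n) (Fin n) ℝ)
    (f : E n × ℝ → E n) (lam : E n × ℝ → ℝ) (C δ t : ℝ) : Prop where
  measurable_b : ∀ i j, AEStronglyMeasurable (fun x => b (x, t) i j) (volume.restrict D)
  measurable_f : ∀ i, AEStronglyMeasurable (fun x => f (x, t) i) (volume.restrict D)
  measurable_lam : AEStronglyMeasurable (fun x => lam (x, t)) (volume.restrict D)
  bounded : ∀ᵐ x ∂(volume.restrict D), (∀ i j, |b (x, t) i j| ≤ C) ∧ (∀ i, |f (x, t) i| ≤ C) ∧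
    |lam (x, t)| ≤ C
  elliptic : ∀ᵐ x ∂(volume.restrict D), ∀ ξ : E n,
    δ * ‖ξ‖ ^ 2 ≤ ∑ i, ∑ j, ξ i * b (x, t) i j * ξ j

lemma abs_coord_le (ξ : E n) (i : Fin n) : |ξ i| ≤ ‖ξ‖ := PiLp.norm_apply_le ξ i

lemma abs_bilin_le {B : Matrix (Fin n) (Fin n) ℝ} (hC : 0 ≤ C) (hB : ∀ i j, |B i j| ≤ C)
    (ξ η : E n) : |∑ i, ∑ j, B i j * ξ j * η i| ≤ n * n * C * (‖ξ‖ * ‖η‖) := by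
  refine (Finset.abs_sum_le_sum_abs _ _).trans ?_
  have h1 : ∀ i : Fin n, |∑ j, B i j * ξ j * η i| ≤ n * (C * (‖ξ‖ * ‖η‖)) := by
    intro i
    refine (Finset.abs_sum_le_sum_abs _ _).trans ?_
    refine (Finset.sum_le_card_nsmul _ _ (C * (‖ξ‖ * ‖η‖)) fun j _ => ?_).trans_eq (by simp)
    rw [abs_mul, abs_mul, mul_assoc]
    have := hB i j
    have := abs_coord_le ξ j
    have := abs_coord_le η i
    gcongr
  refine (Finset.sum_le_card_nsmul _ _ _ fun i _ => h1 i).trans_eq ?_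
  simp
  ring

lemma abs_drift_le {g : E n} (hC : 0 ≤ C) (hg : ∀ i, |g i| ≤ C) (ξ : E n) :
    |∑ i, g i * ξ i| ≤ n * C * ‖ξ‖ := by
  refine (Finset.abs_sum_le_sum_abs _ _).trans ?_
  refine (Finset.sum_le_card_nsmul _ _ (C * ‖ξ‖) fun j _ => ?_).trans_eq (by simp; ring)
  rw [abs_mul]
  have := hg j
  have := abs_coord_le ξ j
  gcongr

/-- The bound for `formA` obtained from the bound `C` for the entries of the coefficients. -/
def formConst (n : ℕ) (C : ℝ) : ℝ := (n * n + n + 1) * C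

lemma formConst_nonneg (hC : 0 ≤ C) : 0 ≤ formConst n C := by unfold formConst; positivity

namespace IsGoodSlice

lemma aestronglyMeasurable (h : IsGoodSlice D b f lam C δ t) (v w : H1 D) :
    AEStronglyMeasurable (formDensity b f lam t v w) (volume.restrict D) := by
  have hv := fun i => (memLp_coord v.grad i).aestronglyMeasurable
  have hw := fun i => (memLp_coord w.grad i).aestronglyMeasurable
  have hv0 := Lp.aestronglyMeasurable v.toH0
  have hw0 := Lp.aestronglyMeasurable w.toH0
  refine AEStronglyMeasurable.add (AEStronglyMeasurable.add (AEStronglyMeasurable.neg ?_)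
    (AEStronglyMeasurable.mul ?_ hw0)) ((h.measurable_lam.mul hv0).mul hw0)
  · exact Finset.aestronglyMeasurable_fun_sum _ fun i _ =>
      Finset.aestronglyMeasurable_fun_sum _ fun j _ =>
        ((h.measurable_b i j).mul (hv j)).mul (hw i)
  · exact Finset.aestronglyMeasurable_fun_sum _ fun i _ => (h.measurable_f i).mul (hv i)

lemma density_le (h : IsGoodSlice D b f lam C δ t) (hC : 0 ≤ C) (v w : H1 D) :
    ∀ᵐ x ∂(volume.restrict D), ‖formDensity b f lam t v w x‖ ≤ formConst n C *
      (‖v.grad x‖ * ‖w.grad x‖ + ‖v.grad x‖ * ‖w.toH0 x‖ + ‖v.toH0 x‖ * ‖w.toH0 x‖) := by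
  filter_upwards [h.bounded] with x hx
  obtain ⟨h1, h2, h3⟩ := hx
  have e1 := abs_bilin_le hC h1 (v.grad x) (w.grad x)
  have e2 := abs_drift_le hC h2 (v.grad x)
  have e3 : |(∑ i, f (x, t) i * v.grad x i) * w.toH0 x| ≤
      n * C * (‖v.grad x‖ * ‖w.toH0 x‖) := by
    rw [abs_mul, ← mul_assoc]
    exact mul_le_mul_of_nonneg_right e2 (abs_nonneg _)
  have e4 : |lam (x, t) * v.toH0 x * w.toH0 x| ≤ C * (‖v.toH0 x‖ * ‖w.toH0 x‖) := by
    rw [abs_mul, abs_mul, mul_assoc]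
    exact mul_le_mul_of_nonneg_right h3 (by positivity)
  have e5 : ‖formDensity b f lam t v w x‖ ≤ n * n * C * (‖v.grad x‖ * ‖w.grad x‖) +
      n * C * (‖v.grad x‖ * ‖w.toH0 x‖) + C * (‖v.toH0 x‖ * ‖w.toH0 x‖) := by
    refine (abs_add_le _ _).trans (add_le_add ((abs_add_le _ _).trans (add_le_add ?_ e3)) e4)
    rw [abs_neg]
    exact e1
  have p1 : (n : ℝ) * n * C ≤ formConst n C := by
    unfold formConst
    nlinarith [mul_nonneg (Nat.cast_nonneg (α := ℝ) n) hC]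
  have p2 : (n : ℝ) * C ≤ formConst n C := by
    unfold formConst
    nlinarith [mul_nonneg (mul_nonneg (Nat.cast_nonneg (α := ℝ) n) (Nat.cast_nonneg n)) hC]
  have p3 : C ≤ formConst n C := by
    unfold formConst
    nlinarith [mul_nonneg (mul_nonneg (Nat.cast_nonneg (α := ℝ) n) (Nat.cast_nonneg n)) hC,
      mul_nonneg (Nat.cast_nonneg (α := ℝ) n) hC]
  refine e5.trans ?_
  rw [mul_add, mul_add]
  gcongr

lemma integrable_norm_mul_norm {F G : Type*} [NormedAddCommGroup F] [NormedAddCommGroup G]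
    (u : Lp F 2 (volume.restrict D)) (w : Lp G 2 (volume.restrict D)) :
    Integrable (fun x => ‖u x‖ * ‖w x‖) (volume.restrict D) :=
  MemLp.integrable_mul (p := 2) (q := 2) (Lp.memLp u).norm (Lp.memLp w).norm

lemma integrable_majorant (v w : H1 D) : Integrable (fun x =>
    ‖v.grad x‖ * ‖w.grad x‖ + ‖v.grad x‖ * ‖w.toH0 x‖ + ‖v.toH0 x‖ * ‖w.toH0 x‖)
      (volume.restrict D) :=
  ((integrable_norm_mul_norm v.grad w.grad).add (integrable_norm_mul_norm v.grad w.toH0)).add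
    (integrable_norm_mul_norm v.toH0 w.toH0)

lemma integrable (h : IsGoodSlice D b f lam C δ t) (hC : 0 ≤ C) (v w : H1 D) :
    Integrable (formDensity b f lam t v w) (volume.restrict D) :=
  ((integrable_majorant v w).const_mul _).mono' (h.aestronglyMeasurable v w) (h.density_le hC v w)

lemma norm_formA_le (h : IsGoodSlice D b f lam C δ t) (hC : 0 ≤ C) (v w : H1 D) :
    ‖formA D b f lam t v w‖ ≤ 3 * formConst n C * ‖v‖ * ‖w‖ := by
  rw [formA_eq]
  refine (norm_integral_le_of_norm_le ((integrable_majorant v w).const_mul _)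
    (h.density_le hC v w)).trans ?_
  have e1 := integral_add ((integrable_norm_mul_norm v.grad w.grad).add
    (integrable_norm_mul_norm v.grad w.toH0)) (integrable_norm_mul_norm v.toH0 w.toH0)
  simp only [Pi.add_apply] at e1
  rw [integral_const_mul, e1, integral_add (integrable_norm_mul_norm v.grad w.grad)
    (integrable_norm_mul_norm v.grad w.toH0)]
  have hM := formConst_nonneg (n := n) hC
  have a1 := (integral_norm_mul_norm_le v.grad w.grad).trans
    (mul_le_mul v.norm_grad_le w.norm_grad_le (norm_nonneg _) (norm_nonneg _))
  have a2 := (integral_norm_mul_norm_le v.grad w.toH0).trans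
    (mul_le_mul v.norm_grad_le w.norm_toH0_le (norm_nonneg _) (norm_nonneg _))
  have a3 := (integral_norm_mul_norm_le v.toH0 w.toH0).trans
    (mul_le_mul v.norm_toH0_le w.norm_toH0_le (norm_nonneg _) (norm_nonneg _))
  calc _ ≤ formConst n C * (‖v‖ * ‖w‖ + ‖v‖ * ‖w‖ + ‖v‖ * ‖w‖) :=
        mul_le_mul_of_nonneg_left (by linarith) hM
    _ = _ := by ring

/-- Additivity of the integral needs integrable densities, so bilinearity of `formA` is derived at
good times only. -/
lemma exists_bilinear (h : IsGoodSlice D b f lam C δ t) (hC : 0 ≤ C) :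
    ∃ A : H1 D →ₗ[ℝ] H1 D →ₗ[ℝ] ℝ, (∀ v w, ‖A v w‖ ≤ 3 * formConst n C * ‖v‖ * ‖w‖) ∧
      ∀ v w, A v w = formA D b f lam t v w := by
  let L : H1 D →ₗ[ℝ] H1 D →ₗ[ℝ] ℝ := LinearMap.mk₂ ℝ (formA D b f lam t)
    (fun v₁ v₂ w => by
      rw [formA_eq, formA_eq, formA_eq, ← integral_add (h.integrable hC _ _) (h.integrable hC _ _)]
      refine integral_congr_ae ?_
      filter_upwards [H1.toH0_add_ae v₁ v₂, H1.grad_add_ae v₁ v₂] with x h1 h2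
      simp only [formDensity, h1, h2, PiLp.add_apply, mul_add, add_mul, Finset.sum_add_distrib]
      ring)
    (fun c v w => by
      rw [formA_eq, formA_eq, smul_eq_mul, ← integral_const_mul]
      refine integral_congr_ae ?_
      filter_upwards [H1.toH0_smul_ae c v, H1.grad_smul_ae c v] with x h1 h2
      simp only [formDensity, h1, h2, PiLp.smul_apply, smul_eq_mul, mul_add, mul_neg,
        Finset.mul_sum, Finset.sum_mul]
      congr 1
      · congr 1
        · congr 1
          exact Finset.sum_congr rfl fun i _ => Finset.sum_congr rfl fun j _ => by ring
        · exact Finset.sum_congr rfl fun i _ => by ring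
      · ring)
    (fun v w₁ w₂ => by
      rw [formA_eq, formA_eq, formA_eq, ← integral_add (h.integrable hC _ _) (h.integrable hC _ _)]
      refine integral_congr_ae ?_
      filter_upwards [H1.toH0_add_ae w₁ w₂, H1.grad_add_ae w₁ w₂] with x h1 h2
      simp only [formDensity, h1, h2, PiLp.add_apply, mul_add, Finset.sum_add_distrib]
      ring)
    (fun c v w => by
      rw [formA_eq, formA_eq, smul_eq_mul, ← integral_const_mul]
      refine integral_congr_ae ?_
      filter_upwards [H1.toH0_smul_ae c w, H1.grad_smul_ae c w] with x h1 h2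
      simp only [formDensity, h1, h2, PiLp.smul_apply, smul_eq_mul, mul_add, mul_neg,
        Finset.mul_sum, Finset.sum_mul]
      congr 1
      · congr 1
        · congr 1
          exact Finset.sum_congr rfl fun i _ => Finset.sum_congr rfl fun j _ => by ring
        · exact Finset.sum_congr rfl fun i _ => by ring
      · ring)
  exact ⟨L, h.norm_formA_le hC, fun v w => rfl⟩

lemma integral_norm_sq {F : Type*} [NormedAddCommGroup F] [InnerProductSpace ℝ F]
    (u : Lp F 2 (volume.restrict D)) : ∫ x in D, ‖u x‖ ^ 2 = ‖u‖ ^ 2 := by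
  rw [← real_inner_self_eq_norm_sq, L2.inner_def]
  simp_rw [real_inner_self_eq_norm_sq]

/-- Gårding's inequality. Half of the ellipticity absorbs the drift by Young's inequality, M|∇v||v|
≤ (δ/2)|∇v|² + (M²/2δ)|v|². The final δ/2 in the constant completes the gradient norm to the full H¹
norm. -/
lemma coercive (h : IsGoodSlice D b f lam C δ t) (hC : 0 ≤ C) (hδ : 0 < δ) (v : H1 D) :
    δ / 2 * ‖v‖ ^ 2 ≤ (formConst n C ^ 2 / (2 * δ) + formConst n C + δ / 2) * ‖v.toH0‖ ^ 2 -
      formA D b f lam t v v := by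
  set M := formConst n C with hM
  have hM0 : 0 ≤ M := formConst_nonneg hC
  have key : ∀ᵐ x ∂(volume.restrict D), δ / 2 * ‖v.grad x‖ ^ 2 ≤
      (M ^ 2 / (2 * δ) + M) * ‖v.toH0 x‖ ^ 2 - formDensity b f lam t v v x := by
    filter_upwards [h.bounded, h.elliptic] with x hx hell
    obtain ⟨-, h2, h3⟩ := hx
    have e1 := hell (v.grad x)
    have e1' : ∑ i, ∑ j, v.grad x i * b (x, t) i j * v.grad x j =
        ∑ i, ∑ j, b (x, t) i j * v.grad x j * v.grad x i :=
      Finset.sum_congr rfl fun i _ => Finset.sum_congr rfl fun j _ => by ring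
    rw [e1'] at e1
    have p2 : (n : ℝ) * C ≤ M := by
      rw [hM]; unfold formConst
      nlinarith [mul_nonneg (mul_nonneg (Nat.cast_nonneg (α := ℝ) n) (Nat.cast_nonneg n)) hC]
    have p3 : C ≤ M := by
      rw [hM]; unfold formConst
      nlinarith [mul_nonneg (mul_nonneg (Nat.cast_nonneg (α := ℝ) n) (Nat.cast_nonneg n)) hC,
        mul_nonneg (Nat.cast_nonneg (α := ℝ) n) hC]
    have e2 : |∑ i, f (x, t) i * v.grad x i| ≤ M * ‖v.grad x‖ :=
      (abs_drift_le hC h2 (v.grad x)).trans (by gcongr)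
    have e3 : (∑ i, f (x, t) i * v.grad x i) * v.toH0 x ≤ M * ‖v.grad x‖ * ‖v.toH0 x‖ := by
      refine (le_abs_self _).trans ?_
      rw [abs_mul]
      exact mul_le_mul_of_nonneg_right e2 (abs_nonneg _)
    have e4 : lam (x, t) * v.toH0 x * v.toH0 x ≤ M * ‖v.toH0 x‖ ^ 2 := by
      rw [mul_assoc, ← sq, Real.norm_eq_abs, sq_abs]
      exact mul_le_mul_of_nonneg_right ((le_abs_self _).trans (h3.trans p3)) (sq_nonneg _)
    have e5 : M * ‖v.grad x‖ * ‖v.toH0 x‖ ≤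
        δ / 2 * ‖v.grad x‖ ^ 2 + M ^ 2 / (2 * δ) * ‖v.toH0 x‖ ^ 2 := by
      have : δ / 2 * ‖v.grad x‖ ^ 2 + M ^ 2 / (2 * δ) * ‖v.toH0 x‖ ^ 2 -
          M * ‖v.grad x‖ * ‖v.toH0 x‖ = (δ * ‖v.grad x‖ - M * ‖v.toH0 x‖) ^ 2 / (2 * δ) := by
        field_simp
        ring
      have h0 : 0 ≤ (δ * ‖v.grad x‖ - M * ‖v.toH0 x‖) ^ 2 / (2 * δ) := by positivity
      linarith
    unfold formDensity
    linarith
  have i1 : Integrable (fun x => ‖v.grad x‖ ^ 2) (volume.restrict D) := by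
    simpa only [sq] using integrable_norm_mul_norm v.grad v.grad
  have i2 : Integrable (fun x => ‖v.toH0 x‖ ^ 2) (volume.restrict D) := by
    simpa only [sq] using integrable_norm_mul_norm v.toH0 v.toH0
  have h1 := integral_mono_ae (i1.const_mul (δ / 2))
    ((i2.const_mul (M ^ 2 / (2 * δ) + M)).sub (h.integrable hC v v)) key
  rw [integral_const_mul, integral_norm_sq, integral_sub' (i2.const_mul _) (h.integrable hC v v),
    integral_const_mul, integral_norm_sq, ← formA_eq] at h1
  rw [H1.norm_sq]
  linarith

end IsGoodSlice

variable {T : ℝ}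

/-- The coefficients live over the open interval and `timeMeasure` over the closed one; the
endpoints are null. -/
lemma restrict_prod_Ioo (T : ℝ) (D : Set (E n)) :
    (volume : Measure (E n × ℝ)).restrict (D ×ˢ Ioo 0 T) =
      (volume.restrict D).prod (timeMeasure T) := by
  rw [Measure.volume_eq_prod, ← Measure.prod_restrict, timeMeasure,
    Measure.restrict_congr_set Ioo_ae_eq_Icc]

lemma ae_ae_of_ae_restrict_prod {p : E n × ℝ → Prop}
    (h : ∀ᵐ q ∂(volume.restrict (D ×ˢ Ioo 0 T)), p q) :
    ∀ᵐ t ∂(timeMeasure T), ∀ᵐ x ∂(volume.restrict D), p (x, t) := by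
  rw [restrict_prod_Ioo] at h
  exact Measure.ae_ae_of_ae_prod
    (Measure.measurePreserving_swap.quasiMeasurePreserving.ae h)

lemma aestronglyMeasurable_swap {F : E n × ℝ → ℝ}
    (h : AEMeasurable F (volume.restrict (D ×ˢ Ioo 0 T))) :
    AEStronglyMeasurable (fun q : ℝ × E n => F (q.2, q.1))
      ((timeMeasure T).prod (volume.restrict D)) := by
  rw [restrict_prod_Ioo] at h
  exact h.aestronglyMeasurable.prod_swap

lemma aestronglyMeasurable_formA (h : IsAdmissibleCoeff T D b f lam) (v w : H1 D) :
    AEStronglyMeasurable (fun t => formA D b f lam t v w) (timeMeasure T) := by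
  have hv := fun i => (memLp_coord v.grad i).aestronglyMeasurable.comp_snd (μ := timeMeasure T)
  have hw := fun i => (memLp_coord w.grad i).aestronglyMeasurable.comp_snd (μ := timeMeasure T)
  have hv0 := (Lp.aestronglyMeasurable v.toH0).comp_snd (μ := timeMeasure T)
  have hw0 := (Lp.aestronglyMeasurable w.toH0).comp_snd (μ := timeMeasure T)
  have hf : ∀ i, AEMeasurable (fun p => f p i) (volume.restrict (D ×ˢ Ioo 0 T)) := fun i =>
    (EuclideanSpace.proj (𝕜 := ℝ) i).continuous.measurable.comp_aemeasurable h.measurable_f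
  have key : AEStronglyMeasurable (fun q : ℝ × E n => formDensity b f lam q.1 v w q.2)
      ((timeMeasure T).prod (volume.restrict D)) := by
    refine AEStronglyMeasurable.add (AEStronglyMeasurable.add (AEStronglyMeasurable.neg ?_)
      (AEStronglyMeasurable.mul ?_ hw0))
      (((aestronglyMeasurable_swap h.measurable_lam).mul hv0).mul hw0)
    · exact Finset.aestronglyMeasurable_fun_sum _ fun i _ =>
        Finset.aestronglyMeasurable_fun_sum _ fun j _ =>
          ((aestronglyMeasurable_swap (h.measurable_b i j)).mul (hv j)).mul (hw i)
    · exact Finset.aestronglyMeasurable_fun_sum _ fun i _ =>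
        (aestronglyMeasurable_swap (hf i)).mul (hv i)
  exact key.integral_prod_right'

lemma abs_entry_le_frobenius (B : Matrix (Fin n) (Fin n) ℝ) (i j : Fin n) : |B i j| ≤ ‖B‖ := by
  have h : ∀ i j, ‖B i j‖ ^ 2 ≤ ∑ i, ∑ j, ‖B i j‖ ^ 2 := fun i j =>
    (Finset.single_le_sum (f := fun j => ‖B i j‖ ^ 2) (fun _ _ => sq_nonneg _)
      (Finset.mem_univ j)).trans (Finset.single_le_sum (f := fun i => ∑ j, ‖B i j‖ ^ 2)
        (fun _ _ => Finset.sum_nonneg fun _ _ => sq_nonneg _) (Finset.mem_univ i))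
  rw [Matrix.frobenius_norm_def, ← Real.sqrt_eq_rpow]
  refine Real.le_sqrt_of_sq_le ?_
  simpa using h i j

lemma exists_isGoodSlice (hD : MeasurableSet D) (h : IsAdmissibleCoeff T D b f lam) :
    ∃ C δ : ℝ, 0 ≤ C ∧ 0 < δ ∧ ∀ᵐ t ∂(timeMeasure T), IsGoodSlice D b f lam C δ t := by
  obtain ⟨C, hC⟩ := h.bounded
  obtain ⟨δ, hδ, hell⟩ := h.elliptic
  have hf : ∀ i, AEMeasurable (fun p => f p i) (volume.restrict (D ×ˢ Ioo 0 T)) := fun i =>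
    (EuclideanSpace.proj (𝕜 := ℝ) i).continuous.measurable.comp_aemeasurable h.measurable_f
  have hIoo : ∀ᵐ t ∂(timeMeasure T), t ∈ Ioo 0 T := by
    rw [timeMeasure, ← Measure.restrict_congr_set Ioo_ae_eq_Icc]
    exact ae_restrict_mem measurableSet_Ioo
  -- If Q is null, for example when D is empty, the essential bound C may be negative.
  refine ⟨max C 0, δ, le_max_right _ _, hδ, ?_⟩
  filter_upwards [hIoo, ae_ae_of_ae_restrict_prod hC,
    ae_all_iff.2 fun i => ae_all_iff.2 fun j =>
      (aestronglyMeasurable_swap (h.measurable_b i j)).prodMk_left,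
    ae_all_iff.2 fun i => (aestronglyMeasurable_swap (hf i)).prodMk_left,
    (aestronglyMeasurable_swap h.measurable_lam).prodMk_left] with t ht h1 h2 h3 h4
  refine ⟨h2, h3, h4, ?_, ?_⟩
  · filter_upwards [h1] with x hx
    have a1 := norm_nonneg (b (x, t))
    have a2 := norm_nonneg (b (x, t))⁻¹
    have a3 := norm_nonneg (f (x, t))
    have a4 := abs_nonneg (lam (x, t))
    have a5 := le_max_left C 0
    exact ⟨fun i j => (abs_entry_le_frobenius _ i j).trans (by linarith),
      fun i => (abs_coord_le _ i).trans (by linarith), by linarith⟩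
  · filter_upwards [ae_restrict_mem hD] with x hx ξ
    exact hell (x, t) ⟨hx, ht⟩ ξ

lemma exists_formBounds (hD : MeasurableSet D) (h : IsAdmissibleCoeff T D b f lam) :
    ∃ M α β : ℝ, 0 ≤ M ∧ 0 < α ∧ IsBoundedFormFamily T M (formA D b f lam) ∧
      ∀ᵐ t ∂(timeMeasure T), ∀ v : H1 D,
        α * ‖v‖ ^ 2 ≤ β * ‖v.toH0‖ ^ 2 - formA D b f lam t v v := by
  obtain ⟨C, δ, hC, hδ, hgood⟩ := exists_isGoodSlice hD h
  refine ⟨3 * formConst n C, δ / 2, formConst n C ^ 2 / (2 * δ) + formConst n C + δ / 2,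
    mul_nonneg (by norm_num) (formConst_nonneg hC),
    half_pos hδ, ⟨aestronglyMeasurable_formA h, ?_⟩, ?_⟩
  · filter_upwards [hgood] with t ht
    exact ht.exists_bilinear hC
  · filter_upwards [hgood] with t ht v
    exact ht.coercive hC hδ v

end SpatialForm

/-- Counterpart of `inner_indicatorConst` for a general integrand; F s 0 = 0 removes the times after
t. -/
lemma integral_indicatorConst {T : ℝ} {V : Type} [NormedAddCommGroup V] {t : ℝ}
    (ht : t ∈ Icc 0 T) {F : ℝ → V → ℝ} (w : V)
    (hF : ∀ᵐ s ∂(timeMeasure T), F s 0 = 0) :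
    ∫ s, F s (indicatorConstLp 2 (measurableSet_Icc : MeasurableSet (Icc 0 t))
      (measure_ne_top (timeMeasure T) _) w s) ∂(timeMeasure T) = ∫ s in (0 : ℝ)..t, F s w := by
  rw [intervalIntegral_eq_timeMeasure ht,
    ← integral_indicator (μ := timeMeasure T) (s := Icc 0 t) measurableSet_Icc]
  refine integral_congr_ae ?_
  filter_upwards [hF, indicatorConstLp_coeFn (p := 2) (μ := timeMeasure T)
    (hs := (measurableSet_Icc : MeasurableSet (Icc 0 t)))
    (hμs := measure_ne_top (timeMeasure T) _) (c := w)] with s h1 h2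
  rw [h2]
  by_cases hs : s ∈ Icc 0 t
  · rw [indicator_of_mem hs, indicator_of_mem hs]
  · rw [indicator_of_notMem hs, indicator_of_notMem hs, h1]

/-! ### The Gram operator and continuity in H -/

section GelfandTriple

variable {T : ℝ} {V H : Type} [NormedAddCommGroup V] [InnerProductSpace ℝ V]
  [NormedAddCommGroup H] [InnerProductSpace ℝ H]

lemma inner_expMul (K : ℝ) (x y : L2Time T V) :
    inner ℝ (expMul K x) y = inner ℝ x (expMul K y) := by
  rw [L2.inner_def, L2.inner_def]
  refine integral_congr_ae ?_
  filter_upwards [expMul_ae K x, expMul_ae K y] with t h1 h2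
  rw [h1, h2, real_inner_smul_left, real_inner_smul_right]

/-- Operators given by a pairing pointwise in time commute with scalar weights in time; this is
applied to A and to the Riesz map. -/
lemma eq_expMul_of_inner {F : ℝ → V → ℝ} {F' : ℝ → V → ℝ} (K : ℝ) {x y : L2Time T V}
    (hx : ∀ w : L2Time T V, inner ℝ x w = ∫ t, F t (w t) ∂(timeMeasure T))
    (hy : ∀ w : L2Time T V, inner ℝ y w = ∫ t, F' t (w t) ∂(timeMeasure T))
    (hF : ∀ᵐ t ∂(timeMeasure T), ∀ w, F' t w = F t (Real.exp (K * t) • w)) :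
    y = expMul K x := by
  refine ext_inner_right ℝ fun w => ?_
  rw [inner_expMul, hx, hy]
  refine integral_congr_ae ?_
  filter_upwards [hF, expMul_ae K w] with t h1 h2
  rw [h1, h2]

lemma intervalIntegral_inner_of_inner {t : ℝ} (ht : t ∈ Icc 0 T) {F : ℝ → V → ℝ}
    {x : L2Time T V} (hx : ∀ w : L2Time T V, inner ℝ x w = ∫ t, F t (w t) ∂(timeMeasure T))
    (hF : ∀ᵐ s ∂(timeMeasure T), F s 0 = 0) (w : V) :
    ∫ s in (0 : ℝ)..t, inner ℝ (x s) w = ∫ s in (0 : ℝ)..t, F s w := by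
  rw [← inner_indicatorConst ht, hx, integral_indicatorConst ht w hF]

variable [CompleteSpace V] [CompleteSpace H]

/-- The Gram operator `ι* ι` acting pointwise in time. -/
def gramL (T : ℝ) (ι : V →L[ℝ] H) : L2Time T V →L[ℝ] L2Time T V :=
  (ι.adjoint.comp ι).compLpL 2 (timeMeasure T)

variable (ι : V →L[ℝ] H)

lemma inner_gramL (x y : L2Time T V) : inner ℝ (gramL T ι x) y =
    inner ℝ (ι.compLpL 2 (timeMeasure T) x) (ι.compLpL 2 (timeMeasure T) y) := by
  rw [L2.inner_def, L2.inner_def]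
  refine integral_congr_ae ?_
  filter_upwards [(ι.adjoint.comp ι).coeFn_compLpL x, ι.coeFn_compLpL x, ι.coeFn_compLpL y]
    with t h1 h2 h3
  rw [h2, h3, gramL, h1, ContinuousLinearMap.comp_apply, ContinuousLinearMap.adjoint_inner_left]

lemma inner_gramL_self (x : L2Time T V) :
    inner ℝ (gramL T ι x) x = ‖ι.compLpL 2 (timeMeasure T) x‖ ^ 2 := by
  rw [inner_gramL, real_inner_self_eq_norm_sq]

lemma inner_gramL_comm (x y : L2Time T V) :
    inner ℝ (gramL T ι x) y = inner ℝ x (gramL T ι y) := by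
  rw [inner_gramL, real_inner_comm _ x, inner_gramL, real_inner_comm]

lemma gramL_volterra (x : L2Time T V) :
    gramL T ι (volterra T V x) = volterra T V (gramL T ι x) :=
  (volterra_compLpL _ x).symm

lemma inner_gramL_volterra_nonneg (x : L2Time T V) :
    0 ≤ inner ℝ (gramL T ι x) (volterra T V x) := by
  rw [inner_gramL, ← volterra_compLpL, real_inner_comm]
  exact inner_volterra_self_nonneg _

lemma denseRange_volterra (hT : 0 < T) : DenseRange (volterra T V) :=
  denseRange_of_adjoint_injective fun _ h => volterra_adjoint_injective hT h

/-- By the energy identity ‖∫₀ᵗ ι x‖² = 2 ∫₀ᵗ ⟨G x, J x⟩ ≤ 2‖G x‖‖J x‖. The uniform norm in H is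
thus controlled by the two quantities that converge along the regularisation. -/
lemma norm_primC_le (x : L2Time T V) :
    ‖primC T H (ι.compLpL 2 (timeMeasure T) x)‖ ≤ ‖gramL T ι x‖ + ‖volterra T V x‖ := by
  rw [ContinuousMap.norm_le _ (by positivity)]
  intro t
  refine le_of_sq_le_sq ?_ (by positivity)
  have h1 : ∫ s in (0 : ℝ)..t, inner ℝ (ι.compLpL 2 (timeMeasure T) x s)
      (volterra T H (ι.compLpL 2 (timeMeasure T) x) s) ≤ ‖gramL T ι x‖ * ‖volterra T V x‖ := by
    have e1 : ∫ s in (0 : ℝ)..t, inner ℝ (ι.compLpL 2 (timeMeasure T) x s)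
        (volterra T H (ι.compLpL 2 (timeMeasure T) x) s) =
        ∫ s in (0 : ℝ)..t, inner ℝ (gramL T ι x s) (volterra T V x s) := by
      refine intervalIntegral_congr_timeMeasure t.2 ?_
      rw [volterra_compLpL]
      filter_upwards [(ι.adjoint.comp ι).coeFn_compLpL x, ι.coeFn_compLpL x,
        ι.coeFn_compLpL (volterra T V x)] with s h1 h2 h3
      rw [h2, h3, gramL, h1, ContinuousLinearMap.comp_apply,
        ContinuousLinearMap.adjoint_inner_left]
    have hint : Integrable (fun s => ‖gramL T ι x s‖ * ‖volterra T V x s‖) (timeMeasure T) :=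
      MemLp.integrable_mul (p := 2) (q := 2) (Lp.memLp _).norm (Lp.memLp _).norm
    rw [e1, intervalIntegral_eq_timeMeasure t.2]
    refine (Real.le_norm_self _).trans ((norm_integral_le_of_norm_le hint.integrableOn
      (ae_of_all _ fun s => norm_inner_le_norm _ _)).trans ?_)
    exact (setIntegral_le_integral hint (ae_of_all _ fun s => by positivity)).trans
      (integral_norm_mul_norm_le _ _)
  rw [energy_primC]
  nlinarith [sq_nonneg ‖gramL T ι x‖, sq_nonneg ‖volterra T V x‖]

/-- A function in `L²([0, T]; V)` with time derivative in `L²([0, T]; V')` is continuous in `H`. -/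
lemma exists_continuous_of_eq (hT : 0 < T) {u g : L2Time T V}
    (h : gramL T ι u = volterra T V g) :
    ∃ c : C(Icc (0 : ℝ) T, H), (∀ᵐ t ∂(timeMeasure T), ∀ ht : t ∈ Icc 0 T, ι (u t) = c ⟨t, ht⟩) ∧
      (∀ h0 : (0 : ℝ) ∈ Icc 0 T, c ⟨0, h0⟩ = 0) ∧
      ∀ (w : V) (t : Icc (0 : ℝ) T), inner ℝ (c t) (ι w) = ∫ s in (0 : ℝ)..t, inner ℝ (g s) w := by
  obtain ⟨x, hx1, hx2⟩ := exists_seq_tendsto_of_eq inner_volterra_self_nonneg (gramL_volterra ι)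
    (denseRange_volterra hT) h
  -- J x_k → u and G x_k → g in L²([0, T]; V), so `norm_primC_le` applied to differences gives
  -- uniform convergence in H.
  have hcauchy : CauchySeq fun k => primC T H (ι.compLpL 2 (timeMeasure T) (x k)) := by
    rw [Metric.cauchySeq_iff']
    intro ε hε
    obtain ⟨N, hN⟩ := Metric.cauchySeq_iff'.1 (hx2.prodMk_nhds hx1).cauchySeq (ε / 2) (half_pos hε)
    refine ⟨N, fun k hk => ?_⟩
    have h1 := hN k hk
    rw [Prod.dist_eq, max_lt_iff, dist_eq_norm, dist_eq_norm, ← map_sub, ← map_sub] at h1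
    rw [dist_eq_norm, ← map_sub, ← map_sub]
    have h2 := norm_primC_le ι (x k - x N)
    linarith [h1.1, h1.2]
  obtain ⟨c, hc⟩ := cauchySeq_tendsto_of_complete hcauchy
  have hct : ∀ t, Tendsto (fun k => primC T H (ι.compLpL 2 (timeMeasure T) (x k)) t) atTop
      (𝓝 (c t)) := fun t => ((continuous_eval_const t).tendsto c).comp hc
  refine ⟨c, ?_, ?_, ?_⟩
  · have h1 : ofC T H c = ι.compLpL 2 (timeMeasure T) u := by
      refine tendsto_nhds_unique (((ofC T H).continuous.tendsto c).comp hc) ?_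
      have := ((ι.compLpL 2 (timeMeasure T)).continuous.tendsto u).comp hx1
      refine this.congr fun k => ?_
      exact (volterra_compLpL ι (x k)).symm
    filter_upwards [ofC_ae c, ι.coeFn_compLpL u] with t h2 h3 ht
    rw [← h3, ← h1, h2 ht]
  · intro h0
    refine tendsto_nhds_unique (hct ⟨0, h0⟩) ?_
    simp [primC_apply]
  · intro w t
    rw [← inner_primC]
    refine tendsto_nhds_unique ((hct t).inner tendsto_const_nhds) ?_
    have h1 : Tendsto (fun k => primC T V (gramL T ι (x k)) t) atTop (𝓝 (primC T V g t)) :=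
      ((continuous_eval_const t).tendsto _).comp (((primC T V).continuous.tendsto g).comp hx2)
    refine (h1.inner (tendsto_const_nhds (x := w))).congr fun k => ?_
    rw [gramL, primC_compLpL, primC_compLpL, ContinuousLinearMap.comp_apply,
      ContinuousLinearMap.adjoint_inner_left]

/-- Converse of `exists_continuous_of_eq`; it transfers uniqueness from the operator equation to
weak solutions. -/
lemma eq_of_continuous {u g : L2Time T V} {c : C(Icc (0 : ℝ) T, H)}
    (hc : ∀ᵐ t ∂(timeMeasure T), ∀ ht : t ∈ Icc 0 T, ι (u t) = c ⟨t, ht⟩)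
    (h : ∀ (w : V) (t : Icc (0 : ℝ) T),
      inner ℝ (c t) (ι w) = ∫ s in (0 : ℝ)..t, inner ℝ (g s) w) :
    gramL T ι u = volterra T V g := by
  refine Lp.ext ?_
  filter_upwards [hc, (ι.adjoint.comp ι).coeFn_compLpL u, volterra_ae g,
    ae_restrict_mem measurableSet_Icc] with t h1 h2 h3 ht
  refine ext_inner_right ℝ fun w => ?_
  rw [gramL, h2, h3, ContinuousLinearMap.comp_apply, ContinuousLinearMap.adjoint_inner_left, h1 ht,
    h w ⟨t, ht⟩, intervalIntegral_inner_const ht]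

lemma expMul_add {F : Type} [NormedAddCommGroup F] [NormedSpace ℝ F] (K : ℝ) (x y : L2Time T F) :
    expMul K (x + y) = expMul K x + expMul K y := (expMulL T F K).map_add x y

lemma expMul_sub {F : Type} [NormedAddCommGroup F] [NormedSpace ℝ F] (K : ℝ) (x y : L2Time T F) :
    expMul K (x - y) = expMul K x - expMul K y := (expMulL T F K).map_sub x y

lemma expMul_smul {F : Type} [NormedAddCommGroup F] [NormedSpace ℝ F] (K c : ℝ)
    (x : L2Time T F) : expMul K (c • x) = c • expMul K x := (expMulL T F K).map_smul c x

lemma gramL_expMul (K : ℝ) (x : L2Time T V) :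
    gramL T ι (expMul K x) = expMul K (gramL T ι x) := (expMul_compLpL _ K x).symm

lemma gramL_expMul_eq (K : ℝ) {u g : L2Time T V} (h : gramL T ι u = volterra T V g) :
    gramL T ι (expMul K u) = volterra T V (expMul K g + K • gramL T ι (expMul K u)) := by
  rw [gramL_expMul, h]
  exact expMul_volterra K g

end GelfandTriple

/-! ### Energy estimates and the fixed point argument -/

section Solvability

variable {T : ℝ} {V H : Type} [NormedAddCommGroup V] [InnerProductSpace ℝ V] [CompleteSpace V]
  [NormedAddCommGroup H] [InnerProductSpace ℝ H] [CompleteSpace H]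
  {ι : V →L[ℝ] H} {A : L2Time T V →L[ℝ] L2Time T V} {α β : ℝ}

lemma shifted_coercive (hA : ∀ x, α * ‖x‖ ^ 2 ≤
      β * ‖ι.compLpL 2 (timeMeasure T) x‖ ^ 2 - inner ℝ (A x) x) (K : ℝ) (x : L2Time T V) :
    α * ‖x‖ ^ 2 + (K - β) * ‖ι.compLpL 2 (timeMeasure T) x‖ ^ 2 ≤
      -inner ℝ ((A - K • gramL T ι) x) x := by
  have h1 : (A - K • gramL T ι) x = A x - K • gramL T ι x := rfl
  rw [h1, inner_sub_left, real_inner_smul_left, inner_gramL_self]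
  linarith [hA x]

lemma exists_linear_solution (hT : 0 < T) (hα : 0 < α)
    (hA : ∀ x, α * ‖x‖ ^ 2 ≤ β * ‖ι.compLpL 2 (timeMeasure T) x‖ ^ 2 - inner ℝ (A x) x)
    {K : ℝ} (hK : β ≤ K) (g : L2Time T V) :
    ∃ u, gramL T ι u = volterra T V ((A - K • gramL T ι) u + g) := by
  refine exists_solution_of_coercive (inner_gramL_comm ι) inner_volterra_self_nonneg
    (gramL_volterra ι) (fun _ h => volterra_injective hT h)
    (fun _ h => volterra_adjoint_injective hT h) (inner_gramL_volterra_nonneg ι) hα (fun x => ?_) g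
  have h1 := shifted_coercive hA K x
  have h2 := mul_nonneg (sub_nonneg.2 hK) (sq_nonneg ‖ι.compLpL 2 (timeMeasure T) x‖)
  linarith

/-- The difference of the solutions solves the linear equation with datum g₁ - g₂. The energy
inequality and shifted coercivity then apply to it. -/
lemma energy_estimate (hT : 0 < T)
    (hA : ∀ x, α * ‖x‖ ^ 2 ≤ β * ‖ι.compLpL 2 (timeMeasure T) x‖ ^ 2 - inner ℝ (A x) x)
    {K : ℝ} {u₁ u₂ g₁ g₂ : L2Time T V}
    (h₁ : gramL T ι u₁ = volterra T V ((A - K • gramL T ι) u₁ + g₁))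
    (h₂ : gramL T ι u₂ = volterra T V ((A - K • gramL T ι) u₂ + g₂)) :
    α * ‖u₁ - u₂‖ ^ 2 + (K - β) * ‖ι.compLpL 2 (timeMeasure T) u₁ -
      ι.compLpL 2 (timeMeasure T) u₂‖ ^ 2 ≤ ‖g₁ - g₂‖ * ‖u₁ - u₂‖ := by
  have h : gramL T ι (u₁ - u₂) =
      volterra T V ((A - K • gramL T ι) (u₁ - u₂) + (g₁ - g₂)) := by
    rw [map_sub, h₁, h₂, ← map_sub, map_sub (A - K • gramL T ι)]
    congr 1
    abel
  have h1 := inner_nonneg_of_eq inner_volterra_self_nonneg (gramL_volterra ι)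
    (denseRange_volterra hT) (inner_gramL_volterra_nonneg ι) h
  rw [inner_add_left] at h1
  have h2 := shifted_coercive hA K (u₁ - u₂)
  rw [map_sub] at h2
  linarith [real_inner_le_norm (g₁ - g₂) (u₁ - u₂)]

lemma contraction_estimate (hT : 0 < T) (hα : 0 < α)
    (hA : ∀ x, α * ‖x‖ ^ 2 ≤ β * ‖ι.compLpL 2 (timeMeasure T) x‖ ^ 2 - inner ℝ (A x) x)
    {K C r : ℝ} (hK : C ^ 2 < α * (K - β)) {u₁ u₂ g₁ g₂ : L2Time T V}
    (h₁ : gramL T ι u₁ = volterra T V ((A - K • gramL T ι) u₁ + g₁))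
    (h₂ : gramL T ι u₂ = volterra T V ((A - K • gramL T ι) u₂ + g₂))
    (hr : 0 ≤ r) (hg : ‖g₁ - g₂‖ ≤ C * r) :
    ‖ι.compLpL 2 (timeMeasure T) u₁ - ι.compLpL 2 (timeMeasure T) u₂‖ ≤ 1 / 2 * r := by
  have h := energy_estimate hT hA h₁ h₂
  set z := ‖ι.compLpL 2 (timeMeasure T) u₁ - ι.compLpL 2 (timeMeasure T) u₂‖
  set d := ‖u₁ - u₂‖
  have hd : 0 ≤ d := norm_nonneg _
  have h2 : α * d ^ 2 + (K - β) * z ^ 2 ≤ C * r * d :=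
    h.trans (mul_le_mul_of_nonneg_right hg hd)
  -- Multiply by 4α and complete the square in d: the terms in d are at least -C²r².
  have h3 : 4 * (α * (K - β)) * z ^ 2 ≤ C ^ 2 * r ^ 2 := by
    nlinarith [sq_nonneg (2 * α * d - C * r)]
  have hpos : 0 < α * (K - β) := (sq_nonneg C).trans_lt hK
  have h4 : C ^ 2 * r ^ 2 ≤ α * (K - β) * r ^ 2 := by gcongr
  refine le_of_sq_le_sq ?_ (by positivity)
  have h5 : α * (K - β) * (4 * z ^ 2) ≤ α * (K - β) * r ^ 2 := by linarith
  have h6 := le_of_mul_le_mul_left h5 hpos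
  rw [mul_pow]
  linarith

/-- Unique solvability of the time-integrated semilinear equation. -/
theorem existsUnique_semilinear (hT : 0 < T) (hα : 0 < α)
    (hA : ∀ x, α * ‖x‖ ^ 2 ≤ β * ‖ι.compLpL 2 (timeMeasure T) x‖ ^ 2 - inner ℝ (A x) x)
    (hAexp : ∀ K x, A (expMul K x) = expMul K (A x))
    {N : L2Time T H → L2Time T V}
    (hN : ∃ K₀ > (0 : ℝ), ∃ C > (0 : ℝ), ∀ K > K₀, ∀ z₁ z₂ : L2Time T H,
      ‖expMul (-K) (N (expMul K z₁)) - expMul (-K) (N (expMul K z₂))‖ ≤ C * ‖z₁ - z₂‖) :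
    ∃! u, gramL T ι u = volterra T V (A u + N (ι.compLpL 2 (timeMeasure T) u)) := by
  obtain ⟨K₀, -, C, -, hN⟩ := hN
  -- K is taken beyond both the threshold of the Lipschitz hypothesis and β + C²/α, the latter
  -- giving the contraction factor 1/2.
  obtain ⟨K, hK1, hK2⟩ : ∃ K, K₀ < K ∧ C ^ 2 < α * (K - β) := by
    refine ⟨max K₀ (β + C ^ 2 / α) + 1, by linarith [le_max_left K₀ (β + C ^ 2 / α)], ?_⟩
    have h1 := le_max_right K₀ (β + C ^ 2 / α)
    rw [← div_lt_iff₀' hα]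
    linarith
  have hKβ : β ≤ K := by
    have : 0 < α * (K - β) := (sq_nonneg C).trans_lt hK2
    have := pos_of_mul_pos_right this hα.le
    linarith
  have hN := hN K hK1
  -- The exponential substitution carries solutions of the original equation to solutions of the
  -- shifted one; `hbwd` goes back.
  have hfwd : ∀ u, gramL T ι u = volterra T V (A u + N (ι.compLpL 2 (timeMeasure T) u)) →
      gramL T ι (expMul (-K) u) = volterra T V ((A - K • gramL T ι) (expMul (-K) u) +
        expMul (-K) (N (expMul K (ι.compLpL 2 (timeMeasure T) (expMul (-K) u))))) := by
    intro u hu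
    rw [gramL_expMul_eq ι (-K) hu, ← expMul_compLpL, expMul_expMul_neg, expMul_add, ← hAexp]
    congr 1
    change _ = A (expMul (-K) u) - K • gramL T ι (expMul (-K) u) + _
    rw [neg_smul]
    abel
  have hbwd : ∀ v, gramL T ι v = volterra T V ((A - K • gramL T ι) v +
        expMul (-K) (N (expMul K (ι.compLpL 2 (timeMeasure T) v)))) →
      gramL T ι (expMul K v) = volterra T V (A (expMul K v) +
        N (ι.compLpL 2 (timeMeasure T) (expMul K v))) := by
    intro v hv
    rw [gramL_expMul_eq ι K hv, expMul_add, expMul_expMul_neg, ← expMul_compLpL, hAexp]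
    congr 1
    change expMul K (A v - K • gramL T ι v) + _ + _ = _
    rw [expMul_sub, expMul_smul, gramL_expMul]
    abel
  choose S hS using exists_linear_solution hT hα hA hKβ
  have hcontr : ContractingWith (1 / 2) fun z => ι.compLpL 2 (timeMeasure T)
      (S (expMul (-K) (N (expMul K z)))) := by
    refine ⟨by norm_num, LipschitzWith.of_dist_le_mul fun z₁ z₂ => ?_⟩
    rw [dist_eq_norm, dist_eq_norm]
    have := contraction_estimate hT hα hA hK2 (hS (expMul (-K) (N (expMul K z₁))))
      (hS (expMul (-K) (N (expMul K z₂)))) (norm_nonneg (z₁ - z₂)) (hN z₁ z₂)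
    simpa using this
  have hz := hcontr.fixedPoint_isFixedPt
  set z := hcontr.fixedPoint with hzdef
  set v := S (expMul (-K) (N (expMul K z))) with hv
  have hz' : ι.compLpL 2 (timeMeasure T) v = z := hz
  have hvs : gramL T ι v = volterra T V ((A - K • gramL T ι) v +
      expMul (-K) (N (expMul K (ι.compLpL 2 (timeMeasure T) v)))) := by
    rw [hz']
    exact hS _
  refine ⟨expMul K v, hbwd v hvs, fun u hu => ?_⟩
  have hu' := hfwd u hu
  -- With r the X⁰ distance of the two solutions this reads r ≤ r/2. The data then coincide, and
  -- `energy_estimate` gives equality in V as well.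
  have h1 := contraction_estimate hT hα hA hK2 hu' hvs (norm_nonneg _) (hN _ _)
  have h2 : ‖ι.compLpL 2 (timeMeasure T) (expMul (-K) u) - ι.compLpL 2 (timeMeasure T) v‖ = 0 :=
    le_antisymm (by linarith) (norm_nonneg _)
  have h3 : ι.compLpL 2 (timeMeasure T) (expMul (-K) u) = ι.compLpL 2 (timeMeasure T) v := by
    rwa [norm_sub_eq_zero_iff] at h2
  have h4 := energy_estimate hT hA hu' hvs
  rw [h3, sub_self, sub_self, norm_zero, norm_zero, zero_mul] at h4
  have h5 : ‖expMul (-K) u - v‖ ^ 2 ≤ 0 := by nlinarith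
  have h6 : expMul (-K) u = v := by
    rw [← sub_eq_zero, ← norm_eq_zero]
    exact pow_eq_zero_iff (two_ne_zero) |>.1 (le_antisymm h5 (sq_nonneg _))
  rw [← h6, expMul_expMul_neg]

end Solvability

/-! ### From the operator equation to weak solutions -/

section WeakSolutions

variable {T : ℝ} {V H : Type} [NormedAddCommGroup V] [InnerProductSpace ℝ V]
  [NormedAddCommGroup H] [InnerProductSpace ℝ H]

lemma IsBoundedFormFamily.integrable_const {M : ℝ} {a : ℝ → V → V → ℝ}
    (h : IsBoundedFormFamily T M a) (u : L2Time T V) (w : V) :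
    Integrable (fun s => a s (u s) w) (timeMeasure T) := by
  refine (h.integrable u (Lp.const 2 (timeMeasure T) w)).congr ?_
  filter_upwards [Lp.coeFn_const 2 (timeMeasure T) w] with s hs
  rw [hs, Function.const_apply]

lemma integrable_dual_apply (φ : L2Time T (StrongDual ℝ V)) (y : L2Time T V) :
    Integrable (fun s => φ s (y s)) (timeMeasure T) := by
  refine Integrable.congr (L1.integrable_coeFn
    ((ContinuousLinearMap.id ℝ (StrongDual ℝ V)).holder 1 φ y)) ?_
  exact (ContinuousLinearMap.id ℝ (StrongDual ℝ V)).coeFn_holder φ y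

variable [CompleteSpace V] [CompleteSpace H]

/-- `(u, c)` is a solution of `(c, ι w)' = a(u, w) + B(ι u) w + φ w`, `c(0) = 0`, where
`c` is the continuous representative of `ι u`. -/
structure IsWeakSolution (ι : V →L[ℝ] H) (a : ℝ → V → V → ℝ)
    (B : L2Time T H → L2Time T (StrongDual ℝ V)) (φ : L2Time T (StrongDual ℝ V))
    (u : L2Time T V) (c : C(Icc (0 : ℝ) T, H)) : Prop where
  compatible : ∀ᵐ t ∂(timeMeasure T), ∀ ht : t ∈ Icc 0 T, ι (u t) = c ⟨t, ht⟩
  equation : ∀ (w : V) (t : Icc (0 : ℝ) T), inner ℝ (c t) (ι w) =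
    ∫ s in (0 : ℝ)..t, (a s (u s) w + B (ι.compLpL 2 (timeMeasure T) u) s w + φ s w)

/-- Riesz representation turns the tested equation into the operator equation of
`existsUnique_semilinear`. Uniqueness is stated for u alone, since c is its continuous
representative. -/
theorem exists_isWeakSolution (hT : 0 < T) {ι : V →L[ℝ] H} {a : ℝ → V → V → ℝ} {M α β : ℝ}
    (hM : 0 ≤ M) (hα : 0 < α) (hform : IsBoundedFormFamily T M a)
    (hcoer : ∀ᵐ t ∂(timeMeasure T), ∀ v, α * ‖v‖ ^ 2 ≤ β * ‖ι v‖ ^ 2 - a t v v)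
    (B : L2Time T H → L2Time T (StrongDual ℝ V))
    (hB : ∃ K₀ > (0 : ℝ), ∃ C > (0 : ℝ), ∀ K > K₀, ∀ z₁ z₂ : L2Time T H,
      ‖expMul (-K) (B (expMul K z₁)) - expMul (-K) (B (expMul K z₂))‖ ≤ C * ‖z₁ - z₂‖)
    (φ : L2Time T (StrongDual ℝ V)) :
    ∃ u c, IsWeakSolution ι a B φ u c ∧ (∀ h : (0 : ℝ) ∈ Icc 0 T, c ⟨0, h⟩ = 0) ∧
      ∀ v d, IsWeakSolution ι a B φ v d → v = u := by
  obtain ⟨A, hA⟩ := hform.exists_operator hM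
  obtain ⟨R, hRn, hR⟩ := exists_riesz T V
  have hcoerA : ∀ x, α * ‖x‖ ^ 2 ≤
      β * ‖ι.compLpL 2 (timeMeasure T) x‖ ^ 2 - inner ℝ (A x) x := by
    intro x
    have e1 : Integrable (fun t => ‖x t‖ ^ 2) (timeMeasure T) :=
      (Lp.memLp x).integrable_norm_pow (by norm_num)
    have e2 : Integrable (fun t => ‖ι.compLpL 2 (timeMeasure T) x t‖ ^ 2) (timeMeasure T) :=
      (Lp.memLp _).integrable_norm_pow (by norm_num)
    rw [← real_inner_self_eq_norm_sq, ← real_inner_self_eq_norm_sq, L2.inner_def, L2.inner_def, hA]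
    simp_rw [real_inner_self_eq_norm_sq]
    rw [← integral_const_mul, ← integral_const_mul,
      ← integral_sub (e2.const_mul β) (hform.integrable x x)]
    refine integral_mono_ae (e1.const_mul α)
      ((e2.const_mul β).sub (hform.integrable x x)) ?_
    filter_upwards [hcoer, ι.coeFn_compLpL x] with t h1 h2
    simp only [h2]
    exact h1 (x t)
  have hAexp : ∀ K x, A (expMul K x) = expMul K (A x) := by
    intro K x
    refine eq_expMul_of_inner K (hA x) (hA (expMul K x)) ?_
    filter_upwards [hform.bounded, expMul_ae K x] with t ht h1 w
    obtain ⟨L, -, hL⟩ := ht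
    rw [h1, ← hL, ← hL, map_smul, map_smul, LinearMap.smul_apply]
  have hRexp : ∀ K ψ, R (expMul K ψ) = expMul K (R ψ) := by
    intro K ψ
    refine eq_expMul_of_inner K (hR ψ) (hR (expMul K ψ)) ?_
    filter_upwards [expMul_ae K ψ] with t h1 w
    rw [h1, map_smul, smul_apply]
  let N : L2Time T H → L2Time T V := fun z => R (B z) + R φ
  have hN : ∃ K₀ > (0 : ℝ), ∃ C > (0 : ℝ), ∀ K > K₀, ∀ z₁ z₂ : L2Time T H,
      ‖expMul (-K) (N (expMul K z₁)) - expMul (-K) (N (expMul K z₂))‖ ≤ C * ‖z₁ - z₂‖ := by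
    obtain ⟨K₀, hK₀, C, hC, h⟩ := hB
    refine ⟨K₀, hK₀, C, hC, fun K hK z₁ z₂ => ?_⟩
    have e : ∀ z, expMul (-K) (N (expMul K z)) =
        R (expMul (-K) (B (expMul K z))) + expMul (-K) (R φ) := by
      intro z
      rw [hRexp, ← expMul_add]
    -- The φ-term cancels and R does not increase norms, so N inherits the constant of B.
    rw [e, e, add_sub_add_right_eq_sub, ← map_sub]
    exact (hRn _).trans (h K hK z₁ z₂)
  have hint : ∀ (u : L2Time T V) (z : L2Time T H) (w : V) (t : Icc (0 : ℝ) T),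
      ∫ s in (0 : ℝ)..t, inner ℝ ((A u + N z) s) w =
        ∫ s in (0 : ℝ)..t, (a s (u s) w + B z s w + φ s w) := by
    intro u z w t
    refine intervalIntegral_inner_of_inner t.2
      (F := fun s w => a s (u s) w + B z s w + φ s w) (x := A u + N z) ?_ ?_ w
    · intro y
      have h1 := hform.integrable u y
      have h2 := fun ψ : L2Time T (StrongDual ℝ V) => integrable_dual_apply ψ y
      have e1 := integral_add (h1.add (h2 (B z))) (h2 φ)
      simp only [Pi.add_apply] at e1
      rw [e1, integral_add h1 (h2 _), inner_add_left, inner_add_left, hA, hR, hR, add_assoc]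
    · filter_upwards [hform.bounded] with s hs
      obtain ⟨L, -, hL⟩ := hs
      rw [← hL, map_zero, map_zero, map_zero, add_zero, add_zero]
  obtain ⟨u, hu, huniq⟩ := existsUnique_semilinear hT hα hcoerA hAexp hN
  obtain ⟨c, hc1, hc2, hc3⟩ := exists_continuous_of_eq ι hT hu
  refine ⟨u, c, ⟨hc1, fun w t => (hc3 w t).trans (hint _ _ w t)⟩, hc2, fun v d hv => huniq _ ?_⟩
  refine eq_of_continuous ι hv.compatible fun w t => ?_
  rw [hint]
  exact hv.equation w t

end WeakSolutions

/-! ### The parabolic problem in Y¹ -/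

section ParabolicEquation

variable {n : ℕ} {T : ℝ} {D : Set (E n)} {b : E n × ℝ → Matrix (Fin n) (Fin n) ℝ}
  {f : E n × ℝ → E n} {lam : E n × ℝ → ℝ}

instance : CompleteSpace (H1 D) :=
  (Submodule.isClosed_topologicalClosure (smoothVanishing D)).completeSpace_coe

/-- The embedding of `H¹` into `H⁰` as a bounded operator. -/
def toH0L (D : Set (E n)) : H1 D →L[ℝ] H0 D :=
  (WithLp.fstL 2 ℝ (Lp ℝ 2 (volume.restrict D)) (Lp (E n) 2 (volume.restrict D))).comp
    (H1sub D).subtypeL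

lemma toH0L_apply (v : H1 D) : toH0L D v = v.toH0 := rfl

lemma Y1.toX0_eq (u : Y1 T D) : u.toX0 = (toH0L D).compLpL 2 (timeMeasure T) u.toX1 := by
  refine Lp.ext ?_
  filter_upwards [(memLp_toH0 u.toX1).coeFn_toLp, (toH0L D).coeFn_compLpL u.toX1] with t h1 h2
  rw [h2, Y1.toX0, h1, toH0L_apply]

lemma Y1.toX1_toC0_ae (u : Y1 T D) :
    ∀ᵐ t ∂(timeMeasure T), ∀ ht : t ∈ Icc 0 T, toH0L D (u.toX1 t) = u.toC0 ⟨t, ht⟩ := u.2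

/-- The element of `Y¹` given by compatible elements of `X¹` and `C([0, T]; H⁰)`. -/
def Y1.mk (v : X1 T D) (c : C(Icc (0 : ℝ) T, H0 D))
    (h : ∀ᵐ t ∂(timeMeasure T), ∀ ht : t ∈ Icc 0 T, toH0L D (v t) = c ⟨t, ht⟩) : Y1 T D :=
  ⟨WithLp.toLp 1 (v, c), h⟩

/-- Continuous functions on [0, T] that agree almost everywhere agree everywhere when T > 0, so the
X¹ component determines the other one. -/
lemma Y1.ext_toX1 (hT : 0 < T) {u v : Y1 T D} (h : u.toX1 = v.toX1) : u = v := by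
  have h2 : u.toC0 = v.toC0 := by
    refine eq_of_ae_eq hT ?_
    filter_upwards [u.toX1_toC0_ae, v.toX1_toC0_ae] with t h1 h2 ht
    rw [← h1 ht, ← h2 ht, h]
  refine Subtype.ext ?_
  refine (WithLp.equiv 1 _).injective (Prod.ext h h2)

theorem existsUnique_isSolution (hT : 0 < T) (hD : MeasurableSet D)
    (hcoeff : IsAdmissibleCoeff T D b f lam) (B : X0 T D → Xneg1 T D)
    (hB : ∃ Kstar > (0 : ℝ), ∃ Cstar > (0 : ℝ), ∀ K > Kstar, ∀ u₁ u₂ : X0 T D,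
      ‖rescale B K u₁ - rescale B K u₂‖ ≤ Cstar * ‖u₁ - u₂‖) (φ : Xneg1 T D) :
    ∃! u : Y1 T D, IsSolution b f lam B φ u := by
  obtain ⟨M, α, β, hM, hα, hform, hcoer⟩ := exists_formBounds hD hcoeff
  -- `hB` has the required form once `rescale` is unfolded, which holds by definition.
  obtain ⟨u, c, hu, hc, huniq⟩ := exists_isWeakSolution (ι := toH0L D) hT hM hα hform hcoer B hB φ
  refine ⟨Y1.mk u c hu.compatible, ⟨hc, fun w => hform.integrable_const u w, fun w t => ?_⟩,
    fun v hv => Y1.ext_toX1 hT (huniq _ v.toC0 ⟨v.toX1_toC0_ae, fun w t => ?_⟩)⟩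
  · rw [Y1.toX0_eq]
    exact hu.equation w t
  · rw [← Y1.toX0_eq]
    exact hv.equation w t

end ParabolicEquation

end Parabolic

end

theorem theorem4 {n : ℕ} (T : ℝ) (hT : 0 < T) (D : Set (Parabolic.E n))
    (hD : Parabolic.IsAdmissibleDomain D)
    (b : Parabolic.E n × ℝ → Matrix (Fin n) (Fin n) ℝ)
    (f : Parabolic.E n × ℝ → Parabolic.E n) (lam : Parabolic.E n × ℝ → ℝ)
    (hcoeff : Parabolic.IsAdmissibleCoeff T D b f lam)
    (B : Parabolic.X0 T D → Parabolic.Xneg1 T D)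
    (hB : ∃ Kstar > (0 : ℝ), ∃ Cstar > (0 : ℝ), ∀ K > Kstar, ∀ u₁ u₂ : Parabolic.X0 T D,
      ‖Parabolic.rescale B K u₁ - Parabolic.rescale B K u₂‖ ≤ Cstar * ‖u₁ - u₂‖) :
    ∀ φ : Parabolic.Xneg1 T D, ∃! u : Parabolic.Y1 T D, Parabolic.IsSolution b f lam B φ u :=
  fun φ => Parabolic.existsUnique_isSolution hT hD.1.measurableSet hcoeff B hB φ
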